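/- Let $f:\mathbb{R}^n\to\mathbb{R}$ be standard self-concordant, i.e. convex, three times continuously differentiable, and $$|\nabla^3 f(x)[h,h,h]|\le 2\,\big(\nabla^2 f(x)[h,h]\big)^{3/2}\qquad\text{for all }x,h\in\mathbb{R}^n .$$ Write $g=\nabla f$ and $G=\nabla^2 f$. Let $x_0\in\mathbb{R}^n$ and suppose that, for some $m>0$, $f$ is $m$-strongly convex on the level set $\Omega=\{x: f(x)\le f(x_0)\}$, i.e. $\Omega$ is convex and $f(ax+by)\le af(x)+bf(y)-\tfrac m2\,ab\,\|x-y\|^2$ for all $x,y\in\Omega$ and $a,b\ge0$ with $a+b=1$. (This holds in particular if $mI\preceq G(x)\preceq MI$ for all $x\in\Omega$, with $0<m\le M$.) Then $f$ has a unique minimizer $x_*$, and the following hold. (a) Adaptive BFGS. Let $H_0$ be any symmetric positive definite matrix and, for $k\ge0$, let $$d_k=-H_kg(x_k),\quad \rho_k=-g(x_k)^Td_k,\quad \delta_k=\sqrt{d_k^TG(x_k)d_k},\quad t_k=\frac{\rho_k}{(\rho_k+\delta_k)\delta_k},\quad x_{k+1}=x_k+t_kd_k,$$ and, with $s_k=x_{k+1}-x_k$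 and $y_k=g(x_{k+1})-g(x_k)$, $$H_{k+1}=\frac{s_ks_k^T}{y_k^Ts_k}+\Big(I-\frac{s_ky_k^T}{y_k^Ts_k}\Big)H_k\Big(I-\frac{y_ks_k^T}{y_k^Ts_k}\Big).$$ Then $x_k\to x_*$ Q-superlinearly. (b) Broyden's convex class without DFP. Let $\varphi_k\in[0,\bar\varphi]$ for all $k$, with $\bar\varphi<1$. Let $B_0$ be any symmetric positive definite matrix, let $H_k=B_k^{-1}$ with $x_{k+1}$ defined from $x_k$ and $H_k$ as in (a), and let $B_{k+1}=(1-\varphi_k)B_{k+1}^{\mathrm{BFGS}}+\varphi_kB_{k+1}^{\mathrm{DFP}}$, where $$B_{k+1}^{\mathrm{BFGS}}=B_k-\frac{B_ks_ks_k^TB_k}{s_k^TB_ks_k}+\frac{y_ky_k^T}{y_k^Ts_k},\qquad B_{k+1}^{\mathrm{DFP}}=\Big(I-\frac{y_ks_k^T}{y_k^Ts_k}\Big)B_k\Big(I-\frac{s_ky_k^T}{y_k^Ts_k}\Big)+\frac{y_ky_k^T}{y_k^Ts_k}.$$ Then $x_k\to x_*$ Q-superlinearly. In both cases the method stops if $g(x_k)=0$,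 and then the iterates are taken to remain at $x_k$. Q-superlinear convergence means that $x_k\to x_*$ and $\|x_{k+1}-x_*\|=o(\|x_k-x_*\|)$ as $k\to\infty$; if the method does not stop, this says $\|x_{k+1}-x_*\|/\|x_k-x_*\|\to0$. -/

import Mathlib

open Filter Topology Asymptotics Matrix

noncomputable section

/-- Standard self-concordance of a finite function on all of `ℝⁿ`: `f` is convex, three times
continuously differentiable, and `|D³f(x)[h,h,h]| ≤ 2 (D²f(x)[h,h])^{3/2}` for all `x` and `h`.
(A finite continuous convex function on `ℝⁿ` is automatically closed.) -/
structure StandardSelfConcordant {n : ℕ} (f : EuclideanSpace ℝ (Fin n) → ℝ) : Prop where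
  convex : ConvexOn ℝ Set.univ f
  contDiff : ContDiff ℝ 3 f
  third_le : ∀ x h : EuclideanSpace ℝ (Fin n),
    |iteratedFDeriv ℝ 3 f x ![h, h, h]| ≤ 2 * (iteratedFDeriv ℝ 2 f x ![h, h]) ^ (3 / 2 : ℝ)

/-- The local norm `‖h‖ₓ = √(hᵀ G(x) h)`, where `G` is the Hessian of `f`. -/
def localNorm {n : ℕ} (f : EuclideanSpace ℝ (Fin n) → ℝ) (x h : EuclideanSpace ℝ (Fin n)) : ℝ :=
  Real.sqrt (iteratedFDeriv ℝ 2 f x ![h, h])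

/-- The search direction `d = -H g(x)`, where `g` is the gradient of `f`. -/
def searchDirection {n : ℕ} (f : EuclideanSpace ℝ (Fin n) → ℝ) (H : Matrix (Fin n) (Fin n) ℝ)
    (x : EuclideanSpace ℝ (Fin n)) : EuclideanSpace ℝ (Fin n) :=
  -Matrix.toEuclideanLin H (gradient f x)

/-- The curvature-adaptive step size `t = ρ / ((ρ + δ) δ)` for the direction `d` at `x`, where
`ρ = -g(x)ᵀ d` and `δ = ‖d‖ₓ`. -/
def adaptiveStepSize {n : ℕ} (f : EuclideanSpace ℝ (Fin n) → ℝ)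
    (x d : EuclideanSpace ℝ (Fin n)) : ℝ :=
  -inner ℝ (gradient f x) d /
    ((-inner ℝ (gradient f x) d + localNorm f x d) * localNorm f x d)

/-- The next iterate `x + t d`. If the gradient vanishes at `x`, then `d = 0` and the next iterate
is `x` itself. -/
def adaptiveStep {n : ℕ} (f : EuclideanSpace ℝ (Fin n) → ℝ) (H : Matrix (Fin n) (Fin n) ℝ)
    (x : EuclideanSpace ℝ (Fin n)) : EuclideanSpace ℝ (Fin n) :=
  x + adaptiveStepSize f x (searchDirection f H x) • searchDirection f H x

/-- The BFGS update of the inverse Hessian approximation,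
`H₊ = s sᵀ / (yᵀ s) + (I - s yᵀ / (yᵀ s)) H (I - y sᵀ / (yᵀ s))`. -/
def bfgsUpdate {n : ℕ} (H : Matrix (Fin n) (Fin n) ℝ) (s y : Fin n → ℝ) :
    Matrix (Fin n) (Fin n) ℝ :=
  (y ⬝ᵥ s)⁻¹ • vecMulVec s s +
    (1 - (y ⬝ᵥ s)⁻¹ • vecMulVec s y) * H * (1 - (y ⬝ᵥ s)⁻¹ • vecMulVec y s)

/-- The BFGS update of the Hessian approximation `B = H⁻¹`,
`B₊ = B - (B s)(B s)ᵀ / (sᵀ B s) + y yᵀ / (yᵀ s)` (for symmetric `B`). -/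
def bfgsHessianUpdate {n : ℕ} (B : Matrix (Fin n) (Fin n) ℝ) (s y : Fin n → ℝ) :
    Matrix (Fin n) (Fin n) ℝ :=
  B - (s ⬝ᵥ (B *ᵥ s))⁻¹ • vecMulVec (B *ᵥ s) (B *ᵥ s) + (y ⬝ᵥ s)⁻¹ • vecMulVec y y

/-- The DFP update of the Hessian approximation,
`B₊ = (I - y sᵀ / (yᵀ s)) B (I - s yᵀ / (yᵀ s)) + y yᵀ / (yᵀ s)`. -/
def dfpHessianUpdate {n : ℕ} (B : Matrix (Fin n) (Fin n) ℝ) (s y : Fin n → ℝ) :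
    Matrix (Fin n) (Fin n) ℝ :=
  (1 - (y ⬝ᵥ s)⁻¹ • vecMulVec y s) * B * (1 - (y ⬝ᵥ s)⁻¹ • vecMulVec s y) +
    (y ⬝ᵥ s)⁻¹ • vecMulVec y y

/-- The Broyden family: `φ = 0` is the BFGS update, `φ = 1` is the DFP update, and the convex class
is `0 ≤ φ ≤ 1`. -/
def broydenHessianUpdate {n : ℕ} (φ : ℝ) (B : Matrix (Fin n) (Fin n) ℝ) (s y : Fin n → ℝ) :
    Matrix (Fin n) (Fin n) ℝ :=
  (1 - φ) • bfgsHessianUpdate B s y + φ • dfpHessianUpdate B s y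

/-- `x` and `H` are sequences produced by the adaptive BFGS method started at `x₀` with some
positive definite initial matrix. The method stops when the gradient vanishes; in that case the
iterates stay where they are and nothing is required of the later matrices. -/
structure IsAdaptiveBFGS {n : ℕ} (f : EuclideanSpace ℝ (Fin n) → ℝ)
    (x₀ : EuclideanSpace ℝ (Fin n)) (x : ℕ → EuclideanSpace ℝ (Fin n))
    (H : ℕ → Matrix (Fin n) (Fin n) ℝ) : Prop where
  start : x 0 = x₀
  posDef : (H 0).PosDef
  step : ∀ k, x (k + 1) = adaptiveStep f (H k) (x k)
  update : ∀ k, gradient f (x k) ≠ 0 →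
    H (k + 1) = bfgsUpdate (H k) (WithLp.ofLp (x (k + 1) - x k))
      (WithLp.ofLp (gradient f (x (k + 1)) - gradient f (x k)))

/-- `x` and `B` are sequences produced by the adaptive Broyden method with parameters `φ k`, started
at `x₀` with some positive definite initial matrix; `H k = (B k)⁻¹`. Stopping is treated as for
BFGS. -/
structure IsAdaptiveBroyden {n : ℕ} (f : EuclideanSpace ℝ (Fin n) → ℝ) (φ : ℕ → ℝ)
    (x₀ : EuclideanSpace ℝ (Fin n)) (x : ℕ → EuclideanSpace ℝ (Fin n))
    (B : ℕ → Matrix (Fin n) (Fin n) ℝ) : Prop where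
  start : x 0 = x₀
  posDef : (B 0).PosDef
  step : ∀ k, x (k + 1) = adaptiveStep f (B k)⁻¹ (x k)
  update : ∀ k, gradient f (x k) ≠ 0 →
    B (k + 1) = broydenHessianUpdate (φ k) (B k) (WithLp.ofLp (x (k + 1) - x k))
      (WithLp.ofLp (gradient f (x (k + 1)) - gradient f (x k)))

/-- Q-superlinear convergence: `x k → a` and `‖x (k+1) - a‖ = o(‖x k - a‖)`. When `x k ≠ a` for all
`k` this says that the quotient of successive errors tends to `0`; a sequence that becomes
constantly equal to `a` also qualifies. -/
def ConvergesQSuperlinearly {n : ℕ} (x : ℕ → EuclideanSpace ℝ (Fin n))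
    (a : EuclideanSpace ℝ (Fin n)) : Prop :=
  Tendsto x atTop (𝓝 a) ∧ (fun k => x (k + 1) - a) =o[atTop] (fun k => x k - a)

end

/-!
# Q-superlinear convergence of adaptive BFGS and of Broyden's convex class without DFP

For a self-concordant `f` the adaptive step size makes the local norm of the step `s` equal to some
`r < 1` and its slope equal to `-r² / (1 - r)`. Integrating the differential inequality
`|v'| ≤ 2 v^(3/2)` for the second derivative `v` along the step shows that such a step satisfies the
Wolfe conditions without any line search (`StandardSelfConcordant.step`). Strong convexity on the
level set then gives `F₊ ≤ (1 - κ c²) F`, where `F` is the distance of `f` to its minimum and `c` is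
the cosine of the angle between `s` and `B s` (`NormalizedBroyden.geometric_decrease`).

The matrices are controlled by the Byrd–Nocedal potential `ψ = tr B - log det B ≥ 0`, in coordinates
in which the Hessian at the minimizer is the identity; the Broyden family is equivariant under such
changes of variables (`transpose_mul_broydenHessianUpdate_mul`). The potential is used twice.

* Far from the minimizer, `ψ₊ ≤ ψ + C + log c²` whenever `c` is small
  (`exists_updatePotential_le_add_log_cosSq`). If `F` did not tend to `0`, then `∑ c²` would be
  finite, `c` would tend to `0`, and `ψ` would tend to `-∞`.
* Near the minimizer, the change `y` of the gradient differs from `s` by at most `e ‖s‖` with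
  `e = O(√F)`. With `p = ‖B s‖² / sᵀ B s`, `q = sᵀ B s / ‖s‖²` and `c² = q / p`,
  `ψ₊ ≤ ψ + 15 e - (ε / 2) ((p - 1 - log p) - log c²)`, where `ε = 1 - φmax > 0`
  (`updatePotential_le_of_near`).
  First, this bounds the mean of `-log c²`, so `F` decays geometrically and `∑ e` is finite. Then
  the nonnegative terms `p - 1 - log p` and `-log c²` are summable, so `p` and `q` tend to `1`
  (`tendsto_zero_of_potential_decrease`).

Thus `‖B s - s‖ = o(‖s‖)`, which is the Dennis–Moré condition. The step sizes tend to `1`, the new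
gradient is `o(‖s‖)`, and Q-superlinear convergence follows from strong convexity. BFGS is the case
`φ = 0` of the Broyden family by the Sherman–Morrison formula (`inv_bfgsUpdate`).
-/

noncomputable section

/-! ### The Broyden family: determinant, trace, equivariance -/

section LinearAlgebra

variable {n : ℕ}

lemma Matrix.det_add_smul_vecMulVec {A : Matrix (Fin n) (Fin n) ℝ} (hA : IsUnit A.det) (c : ℝ)
    (v : Fin n → ℝ) :
    (A + c • vecMulVec v v).det = A.det * (1 + c * (v ⬝ᵥ (A⁻¹ *ᵥ v))) := by
  have h := det_add_replicateCol_mul_replicateRow (ι := Unit) hA (c • v) v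
  have e : replicateCol Unit (c • v) * replicateRow Unit v = c • vecMulVec v v := by
    ext i j; simp [Matrix.mul_apply, vecMulVec_apply, mul_assoc]
  rw [e] at h
  rw [h]
  congr 1
  rw [det_unique]
  have e2 : (replicateRow Unit v * A⁻¹ * replicateCol Unit (c • v)) =
      replicateRow Unit v * (replicateCol Unit (A⁻¹ *ᵥ (c • v))) := by
    rw [Matrix.mul_assoc]; congr 1
  rw [e2]
  simp [Matrix.mul_apply, mulVec_smul, dotProduct, Finset.mul_sum]

lemma Matrix.PosDef.mulVec_vecMul {B : Matrix (Fin n) (Fin n) ℝ} (hB : B.PosDef)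
    (s : Fin n → ℝ) : s ᵥ* B = B *ᵥ s := by
  have := hB.isHermitian.eq
  rw [conjTranspose_eq_transpose_of_trivial] at this
  conv_lhs => rw [← this]
  exact vecMul_transpose B s

/-- The update of the Broyden family is the BFGS update plus a nonnegative multiple of a rank-one
matrix `v vᵀ`. -/
lemma broydenHessianUpdate_eq {B : Matrix (Fin n) (Fin n) ℝ} (hB : B.PosDef) (φ : ℝ)
    {s y : Fin n → ℝ} (hs : s ⬝ᵥ (B *ᵥ s) ≠ 0) :
    broydenHessianUpdate φ B s y = bfgsHessianUpdate B s y + (φ * (s ⬝ᵥ (B *ᵥ s))) •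
      vecMulVec ((y ⬝ᵥ s)⁻¹ • y - (s ⬝ᵥ (B *ᵥ s))⁻¹ • (B *ᵥ s))
        ((y ⬝ᵥ s)⁻¹ • y - (s ⬝ᵥ (B *ᵥ s))⁻¹ • (B *ᵥ s)) := by
  have h1 : dfpHessianUpdate B s y = B - (y ⬝ᵥ s)⁻¹ • vecMulVec y (B *ᵥ s)
      - (y ⬝ᵥ s)⁻¹ • vecMulVec (B *ᵥ s) y
      + ((y ⬝ᵥ s)⁻¹ * (y ⬝ᵥ s)⁻¹ * (s ⬝ᵥ (B *ᵥ s))) • vecMulVec y y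
      + (y ⬝ᵥ s)⁻¹ • vecMulVec y y := by
    unfold dfpHessianUpdate
    congr 1
    rw [sub_mul, one_mul, mul_sub, mul_one, Matrix.smul_mul, vecMulVec_mul, Matrix.mul_smul,
      sub_mul, mul_vecMulVec, Matrix.smul_mul, vecMulVec_mul_vecMulVec, hB.mulVec_vecMul,
      dotProduct_comm (B *ᵥ s) s]
    ext i j
    simp [vecMulVec_apply]
    ring
  unfold broydenHessianUpdate
  rw [h1]
  ext i j
  simp only [bfgsHessianUpdate, Matrix.add_apply, Matrix.sub_apply, Matrix.smul_apply,
    vecMulVec_apply, smul_eq_mul, Pi.sub_apply, Pi.smul_apply]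
  field_simp
  ring

/-- The factor `F = I + w sᵀ`, with `w = y / √((yᵀ s) (sᵀ B s)) - B s / (sᵀ B s)`, for which the
BFGS update of `B` is `F B Fᵀ`. -/
def bfgsFactor (B : Matrix (Fin n) (Fin n) ℝ) (s y : Fin n → ℝ) : Matrix (Fin n) (Fin n) ℝ :=
  1 + vecMulVec ((Real.sqrt ((y ⬝ᵥ s) * (s ⬝ᵥ (B *ᵥ s))))⁻¹ • y
    - (s ⬝ᵥ (B *ᵥ s))⁻¹ • (B *ᵥ s)) s

lemma bfgsHessianUpdate_eq_factor {B : Matrix (Fin n) (Fin n) ℝ} (hB : B.PosDef)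
    {s y : Fin n → ℝ} (hs : 0 < s ⬝ᵥ (B *ᵥ s)) (hy : 0 < y ⬝ᵥ s) :
    bfgsHessianUpdate B s y = bfgsFactor B s y * B * (bfgsFactor B s y)ᵀ := by
  have hsq : Real.sqrt ((y ⬝ᵥ s) * (s ⬝ᵥ (B *ᵥ s))) ^ 2 = (y ⬝ᵥ s) * (s ⬝ᵥ (B *ᵥ s)) :=
    Real.sq_sqrt (by positivity)
  have hr : 0 < Real.sqrt ((y ⬝ᵥ s) * (s ⬝ᵥ (B *ᵥ s))) := Real.sqrt_pos.2 (by positivity)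
  unfold bfgsFactor bfgsHessianUpdate
  set r := Real.sqrt ((y ⬝ᵥ s) * (s ⬝ᵥ (B *ᵥ s)))
  set b := s ⬝ᵥ (B *ᵥ s) with hb
  set c := y ⬝ᵥ s
  have hc : c = r ^ 2 / b := by rw [hsq]; field_simp
  rw [transpose_add, transpose_one, transpose_vecMulVec, add_mul, one_mul, vecMulVec_mul,
    hB.mulVec_vecMul, mul_add, mul_one, add_mul, mul_vecMulVec, vecMulVec_mul_vecMulVec,
    dotProduct_comm (B *ᵥ s) s, ← hb, hc]
  ext i j
  simp only [Matrix.add_apply, Matrix.sub_apply, Matrix.smul_apply,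
    vecMulVec_apply, smul_eq_mul, Pi.sub_apply, Pi.smul_apply]
  field_simp
  ring

lemma det_bfgsFactor {B : Matrix (Fin n) (Fin n) ℝ}
    {s y : Fin n → ℝ} (hs : 0 < s ⬝ᵥ (B *ᵥ s)) :
    (bfgsFactor B s y).det = (Real.sqrt ((y ⬝ᵥ s) * (s ⬝ᵥ (B *ᵥ s))))⁻¹ * (y ⬝ᵥ s) := by
  have := det_one_add_replicateCol_mul_replicateRow (ι := Unit)
    ((Real.sqrt ((y ⬝ᵥ s) * (s ⬝ᵥ (B *ᵥ s))))⁻¹ • y - (s ⬝ᵥ (B *ᵥ s))⁻¹ • (B *ᵥ s)) s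
  rw [← vecMulVec_eq] at this
  rw [bfgsFactor, this, dotProduct_sub, dotProduct_smul, dotProduct_smul, smul_eq_mul,
    smul_eq_mul, inv_mul_cancel₀ hs.ne', dotProduct_comm s y]
  ring

lemma posDef_bfgsHessianUpdate {B : Matrix (Fin n) (Fin n) ℝ} (hB : B.PosDef)
    {s y : Fin n → ℝ} (hs : 0 < s ⬝ᵥ (B *ᵥ s)) (hy : 0 < y ⬝ᵥ s) :
    (bfgsHessianUpdate B s y).PosDef := by
  have hu : IsUnit (bfgsFactor B s y) := by
    rw [Matrix.isUnit_iff_isUnit_det, det_bfgsFactor hs, isUnit_iff_ne_zero]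
    have : 0 < Real.sqrt ((y ⬝ᵥ s) * (s ⬝ᵥ (B *ᵥ s))) := Real.sqrt_pos.2 (by positivity)
    positivity
  rw [bfgsHessianUpdate_eq_factor hB hs hy]
  exact (Matrix.IsUnit.posDef_star_right_conjugate_iff hu).2 hB

lemma det_bfgsHessianUpdate {B : Matrix (Fin n) (Fin n) ℝ} (hB : B.PosDef)
    {s y : Fin n → ℝ} (hs : 0 < s ⬝ᵥ (B *ᵥ s)) (hy : 0 < y ⬝ᵥ s) :
    (bfgsHessianUpdate B s y).det = B.det * ((y ⬝ᵥ s) / (s ⬝ᵥ (B *ᵥ s))) := by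
  have hsq : Real.sqrt ((y ⬝ᵥ s) * (s ⬝ᵥ (B *ᵥ s))) ^ 2 = (y ⬝ᵥ s) * (s ⬝ᵥ (B *ᵥ s)) :=
    Real.sq_sqrt (by positivity)
  have hr : 0 < Real.sqrt ((y ⬝ᵥ s) * (s ⬝ᵥ (B *ᵥ s))) := Real.sqrt_pos.2 (by positivity)
  rw [bfgsHessianUpdate_eq_factor hB hs hy, det_mul, det_mul, det_transpose, det_bfgsFactor hs]
  rw [show ∀ a b : ℝ, a⁻¹ * (y ⬝ᵥ s) * b * (a⁻¹ * (y ⬝ᵥ s)) = b * ((y ⬝ᵥ s) ^ 2 / a ^ 2) by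
    intro a b; ring, hsq]
  field_simp

lemma posDef_broydenHessianUpdate {B : Matrix (Fin n) (Fin n) ℝ} (hB : B.PosDef)
    {φ : ℝ} (hφ : 0 ≤ φ)
    {s y : Fin n → ℝ} (hs : 0 < s ⬝ᵥ (B *ᵥ s)) (hy : 0 < y ⬝ᵥ s) :
    (broydenHessianUpdate φ B s y).PosDef := by
  rw [broydenHessianUpdate_eq hB φ hs.ne']
  refine (posDef_bfgsHessianUpdate hB hs hy).add_posSemidef (PosSemidef.smul ?_ (by positivity))
  exact posSemidef_vecMulVec_self_star _

/-- The rank-one term that distinguishes the Broyden update from BFGS can only increase the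
determinant. -/
lemma le_det_broydenHessianUpdate {B : Matrix (Fin n) (Fin n) ℝ} (hB : B.PosDef)
    {φ : ℝ} (hφ : 0 ≤ φ)
    {s y : Fin n → ℝ} (hs : 0 < s ⬝ᵥ (B *ᵥ s)) (hy : 0 < y ⬝ᵥ s) :
    B.det * ((y ⬝ᵥ s) / (s ⬝ᵥ (B *ᵥ s))) ≤ (broydenHessianUpdate φ B s y).det := by
  have hP := posDef_bfgsHessianUpdate hB hs hy
  rw [broydenHessianUpdate_eq hB φ hs.ne', ← det_bfgsHessianUpdate hB hs hy,
    det_add_smul_vecMulVec hP.det_pos.ne'.isUnit]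
  refine le_mul_of_one_le_right hP.det_pos.le ?_
  have := hP.inv.posSemidef.dotProduct_mulVec_nonneg
    ((y ⬝ᵥ s)⁻¹ • y - (s ⬝ᵥ (B *ᵥ s))⁻¹ • (B *ᵥ s))
  simp only [star_trivial] at this
  have h2 := mul_nonneg (mul_nonneg hφ hs.le) this
  linarith

lemma trace_broydenHessianUpdate {B : Matrix (Fin n) (Fin n) ℝ} (hB : B.PosDef) (φ : ℝ)
    {s y : Fin n → ℝ} (hs : 0 < s ⬝ᵥ (B *ᵥ s)) (hy : 0 < y ⬝ᵥ s) :
    (broydenHessianUpdate φ B s y).trace = B.trace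
      - (1 - φ) * (((B *ᵥ s) ⬝ᵥ (B *ᵥ s)) / (s ⬝ᵥ (B *ᵥ s)))
      + (y ⬝ᵥ y) / (y ⬝ᵥ s) * (1 + φ * ((s ⬝ᵥ (B *ᵥ s)) / (y ⬝ᵥ s)))
      - 2 * φ * ((y ⬝ᵥ (B *ᵥ s)) / (y ⬝ᵥ s)) := by
  rw [broydenHessianUpdate_eq hB φ hs.ne']
  simp only [bfgsHessianUpdate, trace_add, trace_sub, trace_smul, trace_vecMulVec, smul_eq_mul,
    dotProduct_sub, sub_dotProduct, dotProduct_smul, smul_dotProduct]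
  rw [dotProduct_comm (B *ᵥ s) y]
  field_simp
  ring

/-- Equivariance of the Broyden family under the change of variables `s = Q s'`. -/
lemma transpose_mul_broydenHessianUpdate_mul {B : Matrix (Fin n) (Fin n) ℝ} (hB : B.PosDef) (φ : ℝ)
    {Q : Matrix (Fin n) (Fin n) ℝ} (hQ : IsUnit Q)
    (s y : Fin n → ℝ) (hs : 0 < (Q *ᵥ s) ⬝ᵥ (B *ᵥ (Q *ᵥ s))) :
    Qᵀ * broydenHessianUpdate φ B (Q *ᵥ s) y * Q =
      broydenHessianUpdate φ (Qᵀ * B * Q) s (Qᵀ *ᵥ y) := by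
  have hB' : (Qᵀ * B * Q).PosDef := (Matrix.IsUnit.posDef_star_left_conjugate_iff hQ).2 hB
  have e1 : (Qᵀ * B * Q) *ᵥ s = Qᵀ *ᵥ (B *ᵥ (Q *ᵥ s)) := by simp [Matrix.mul_assoc]
  have e2 : s ⬝ᵥ ((Qᵀ * B * Q) *ᵥ s) = (Q *ᵥ s) ⬝ᵥ (B *ᵥ (Q *ᵥ s)) := by
    rw [e1, dotProduct_mulVec, vecMul_transpose]
  have e3 : (Qᵀ *ᵥ y) ⬝ᵥ s = y ⬝ᵥ (Q *ᵥ s) := by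
    rw [dotProduct_comm, dotProduct_mulVec, vecMul_transpose, dotProduct_comm]
  have key : ∀ a b : Fin n → ℝ, Qᵀ * vecMulVec a b * Q = vecMulVec (Qᵀ *ᵥ a) (Qᵀ *ᵥ b) := by
    intro a b
    rw [mul_vecMulVec, vecMulVec_mul, mulVec_transpose Q b]
  rw [broydenHessianUpdate_eq hB φ hs.ne', broydenHessianUpdate_eq hB' φ (by rw [e2]; exact hs.ne')]
  rw [e1] at e2
  simp only [bfgsHessianUpdate, e1, e2, e3, mul_add, mul_sub, add_mul, sub_mul, key,
    Matrix.mul_smul, Matrix.smul_mul, mulVec_sub, mulVec_smul]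

/-- The Sherman–Morrison form of the BFGS update. -/
lemma inv_bfgsUpdate {H : Matrix (Fin n) (Fin n) ℝ} (hH : H.PosDef) {s y : Fin n → ℝ}
    (hs : 0 < s ⬝ᵥ (H⁻¹ *ᵥ s)) (hy : 0 < y ⬝ᵥ s) :
    (bfgsUpdate H s y)⁻¹ = bfgsHessianUpdate H⁻¹ s y := by
  apply Matrix.inv_eq_left_inv
  have hu := hH.isUnit
  have hd : IsUnit H.det := (Matrix.isUnit_iff_isUnit_det _).1 hu
  have hBs : ∀ v, H⁻¹ *ᵥ (H *ᵥ v) = v := by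
    intro v; rw [mulVec_mulVec, nonsing_inv_mul _ hd, one_mulVec]
  have hc := hy.ne'
  have hb := hs.ne'
  have hsym : ∀ v, (H⁻¹ *ᵥ s) ⬝ᵥ (H *ᵥ v) = s ⬝ᵥ v := by
    intro v
    rw [← hH.inv.mulVec_vecMul, ← dotProduct_mulVec, hBs]
  refine Matrix.ext_of_mulVec_single fun i => ?_
  generalize (Pi.single i 1 : Fin n → ℝ) = v
  rw [one_mulVec, ← mulVec_mulVec]
  have h1 : bfgsUpdate H s y *ᵥ v = ((y ⬝ᵥ s)⁻¹ * (s ⬝ᵥ v)) • s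
      + (H *ᵥ (v - ((y ⬝ᵥ s)⁻¹ * (s ⬝ᵥ v)) • y)
        - ((y ⬝ᵥ s)⁻¹ * (y ⬝ᵥ (H *ᵥ (v - ((y ⬝ᵥ s)⁻¹ * (s ⬝ᵥ v)) • y)))) • s) := by
    simp only [bfgsUpdate, add_mulVec, ← mulVec_mulVec, sub_mulVec, one_mulVec, smul_mulVec,
      vecMulVec_mulVec, op_smul_eq_smul, smul_smul]
  rw [h1]
  set c := y ⬝ᵥ s with hcd
  set x := H *ᵥ (v - (c⁻¹ * (s ⬝ᵥ v)) • y) with hx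
  have hx1 : H⁻¹ *ᵥ x = v - (c⁻¹ * (s ⬝ᵥ v)) • y := hBs _
  have hx2 : (H⁻¹ *ᵥ s) ⬝ᵥ x = 0 := by
    rw [hx, hsym, dotProduct_sub, dotProduct_smul, dotProduct_comm s y, smul_eq_mul]
    change _ - c⁻¹ * _ * c = 0
    field_simp; ring
  simp only [bfgsHessianUpdate, add_mulVec, sub_mulVec, smul_mulVec, mulVec_add, mulVec_sub,
    mulVec_smul, vecMulVec_mulVec, op_smul_eq_smul, hx1, hx2, smul_smul,
    dotProduct_comm (H⁻¹ *ᵥ s) s,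
    ← hcd]
  ext j
  simp only [Pi.add_apply, Pi.sub_apply, Pi.smul_apply, smul_eq_mul]
  field_simp
  ring

lemma Matrix.PosDef.exists_transpose_mul_mul_eq_one {A : Matrix (Fin n) (Fin n) ℝ} (hA : A.PosDef) :
    ∃ Q : Matrix (Fin n) (Fin n) ℝ, IsUnit Q ∧ Qᵀ * A * Q = 1 := by
  open scoped MatrixOrder in
  have h0 : 0 ≤ A := nonneg_iff_posSemidef.2 hA.posSemidef
  have h1 : CFC.sqrt A * CFC.sqrt A = A := CFC.sqrt_mul_sqrt_self A h0
  have h2 : (CFC.sqrt A).PosSemidef := nonneg_iff_posSemidef.1 (CFC.sqrt_nonneg A)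
  have h3 : (CFC.sqrt A)ᵀ = CFC.sqrt A := by
    have := h2.isHermitian.eq
    rwa [conjTranspose_eq_transpose_of_trivial] at this
  have hd : IsUnit (CFC.sqrt A).det := by
    have h4 : (CFC.sqrt A).det * (CFC.sqrt A).det = A.det := by rw [← det_mul, h1]
    rw [isUnit_iff_ne_zero]
    intro h
    rw [h, zero_mul] at h4
    exact hA.det_pos.ne h4
  refine ⟨(CFC.sqrt A)⁻¹, ?_, ?_⟩
  · rw [isUnit_nonsing_inv_iff, isUnit_iff_isUnit_det]; exact hd
  · rw [transpose_nonsing_inv, h3]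
    nth_rewrite 2 [← h1]
    rw [← Matrix.mul_assoc, nonsing_inv_mul _ hd, one_mul, mul_nonsing_inv _ hd]

/-- Each eigenvalue contributes `λ - log λ ≥ 1`. -/
lemma zero_le_trace_sub_log_det {B : Matrix (Fin n) (Fin n) ℝ} (hB : B.PosDef) :
    0 ≤ B.trace - Real.log B.det := by
  have h := hB.isHermitian
  rw [h.trace_eq_sum_eigenvalues, h.det_eq_prod_eigenvalues, Real.log_prod]
  · rw [← Finset.sum_sub_distrib]
    refine Finset.sum_nonneg fun i _ => ?_
    have := Real.log_le_sub_one_of_pos (hB.eigenvalues_pos i)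
    simp only [RCLike.ofReal_real_eq_id, id_eq]
    linarith
  · intro i _
    simpa using (hB.eigenvalues_pos i).ne'

end LinearAlgebra

/-! ### The potential `tr B - log det B` -/

section Potential

variable {n : ℕ}

/-- The Byrd–Nocedal potential `tr B - log det B`. -/
def updatePotential (B : Matrix (Fin n) (Fin n) ℝ) : ℝ := B.trace - Real.log B.det

/-- The quotient `‖B s‖² / sᵀ B s`. -/
def imageQuotient (B : Matrix (Fin n) (Fin n) ℝ) (s : Fin n → ℝ) : ℝ :=
  ((B *ᵥ s) ⬝ᵥ (B *ᵥ s)) / (s ⬝ᵥ (B *ᵥ s))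

/-- The Rayleigh quotient `sᵀ B s / ‖s‖²`. -/
def rayleighQuotient (B : Matrix (Fin n) (Fin n) ℝ) (s : Fin n → ℝ) : ℝ :=
  (s ⬝ᵥ (B *ᵥ s)) / (s ⬝ᵥ s)

/-- The squared cosine of the angle between `s` and `B s`. -/
def cosSq (B : Matrix (Fin n) (Fin n) ℝ) (s : Fin n → ℝ) : ℝ :=
  rayleighQuotient B s / imageQuotient B s

/-- The exact trace formula combined with the lower bound for the determinant. -/
lemma updatePotential_broydenHessianUpdate_le {B : Matrix (Fin n) (Fin n) ℝ} (hB : B.PosDef)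
    {φ : ℝ} (hφ : 0 ≤ φ) {s y : Fin n → ℝ} (hs : 0 < s ⬝ᵥ (B *ᵥ s)) (hy : 0 < y ⬝ᵥ s) :
    updatePotential (broydenHessianUpdate φ B s y) ≤ updatePotential B
      - (1 - φ) * imageQuotient B s
      + (y ⬝ᵥ y) / (y ⬝ᵥ s) * (1 + φ * ((s ⬝ᵥ (B *ᵥ s)) / (y ⬝ᵥ s)))
      - 2 * φ * ((y ⬝ᵥ (B *ᵥ s)) / (y ⬝ᵥ s)) + Real.log ((s ⬝ᵥ (B *ᵥ s)) / (y ⬝ᵥ s)) := by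
  have h1 := le_det_broydenHessianUpdate hB hφ hs hy
  have h0 := hB.det_pos
  have h2 : 0 < B.det * ((y ⬝ᵥ s) / (s ⬝ᵥ (B *ᵥ s))) := by positivity
  have h3 := Real.log_le_log h2 h1
  rw [Real.log_mul h0.ne' (by positivity), ← inv_div, Real.log_inv] at h3
  rw [updatePotential, updatePotential, trace_broydenHessianUpdate hB φ hs hy, imageQuotient]
  linarith

lemma sq_dotProduct_le (u v : Fin n → ℝ) : (u ⬝ᵥ v) ^ 2 ≤ (u ⬝ᵥ u) * (v ⬝ᵥ v) := by
  simp only [dotProduct, ← pow_two]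
  exact Finset.sum_mul_sq_le_sq_mul_sq _ _ _

lemma dotProduct_self_pos {s : Fin n → ℝ} (hs : s ≠ 0) : 0 < s ⬝ᵥ s := by
  have := Matrix.dotProduct_star_self_pos_iff.2 hs
  simpa using this

section Quotients

variable {B : Matrix (Fin n) (Fin n) ℝ} {s : Fin n → ℝ}

lemma dotProduct_mulVec_self_pos (hB : B.PosDef) (hs : s ≠ 0) : 0 < s ⬝ᵥ (B *ᵥ s) := by
  simpa using hB.dotProduct_mulVec_pos hs

lemma rayleighQuotient_pos (hB : B.PosDef) (hs : s ≠ 0) : 0 < rayleighQuotient B s :=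
  div_pos (dotProduct_mulVec_self_pos hB hs) (dotProduct_self_pos hs)

lemma imageQuotient_pos (hB : B.PosDef) (hs : s ≠ 0) : 0 < imageQuotient B s := by
  refine div_pos (dotProduct_self_pos fun h => ?_) (dotProduct_mulVec_self_pos hB hs)
  have := dotProduct_mulVec_self_pos hB hs
  simp [h] at this

lemma cosSq_pos (hB : B.PosDef) (hs : s ≠ 0) : 0 < cosSq B s :=
  div_pos (rayleighQuotient_pos hB hs) (imageQuotient_pos hB hs)

lemma rayleighQuotient_le_imageQuotient (hB : B.PosDef) (hs : s ≠ 0) :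
    rayleighQuotient B s ≤ imageQuotient B s := by
  have h := sq_dotProduct_le s (B *ᵥ s)
  rw [rayleighQuotient, imageQuotient, div_le_div_iff₀ (dotProduct_self_pos hs)
    (dotProduct_mulVec_self_pos hB hs)]
  linarith

lemma cosSq_le_one (hB : B.PosDef) (hs : s ≠ 0) : cosSq B s ≤ 1 :=
  (div_le_one (imageQuotient_pos hB hs)).2 (rayleighQuotient_le_imageQuotient hB hs)

end Quotients

end Potential

lemma Real.log_le_half_mul_add {ε p : ℝ} (hε : 0 < ε) (hp : 0 < p) :
    Real.log p ≤ ε / 2 * p + Real.log (2 / ε) := by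
  have h := Real.log_le_sub_one_of_pos (show 0 < ε / 2 * p by positivity)
  rw [Real.log_mul (by positivity) hp.ne', show ε / 2 = (2 / ε)⁻¹ by rw [inv_div],
    Real.log_inv, inv_div] at h
  linarith

/-- An upper bound for the increment of the potential that needs only `yᵀ s ≥ m₁ ‖s‖²` and
`‖y‖ ≤ M₁ ‖s‖`, provided the cosine `c` of the angle between `s` and `B s` is small. Here
`Z = ‖s‖²`, `S = sᵀ B s`, `a = yᵀ s`, `Y = ‖y‖²`, `X = yᵀ B s`, `p = ‖B s‖² / sᵀ B s` and
`q = sᵀ B s / ‖s‖²`. The mixed terms are `O(p c)`, so a small `c` lets the term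
`-(1 - φ) p` absorb them. -/
lemma coarse_increment_le {m₁ M₁ ε φ p q c a Y X Z S : ℝ} (hm : 0 < m₁) (hM : 0 < M₁) (hε : 0 < ε)
    (hφ : 0 ≤ φ) (hφε : φ ≤ 1 - ε) (hp : 0 < p) (hc : 0 < c) (hc1 : c ≤ 1)
    (hq : q = p * c ^ 2) (hZ : 0 < Z) (hS : S = q * Z) (ha : m₁ * Z ≤ a) (hY : Y ≤ M₁ ^ 2 * Z)
    (hX : X ^ 2 ≤ Y * (p * S))
    (hcγ : c * (M₁ ^ 2 / m₁ ^ 2 + 2 * M₁ / m₁) ≤ ε / 2) :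
    -(1 - φ) * p + Y / a * (1 + φ * (S / a)) - 2 * φ * (X / a) + Real.log (S / a) ≤
      M₁ ^ 2 / m₁ - Real.log m₁ + Real.log (2 / ε) + Real.log (q / p) := by
  have hq0 : 0 < q := by rw [hq]; positivity
  have hS0 : 0 < S := by rw [hS]; positivity
  have ha0 : 0 < a := lt_of_lt_of_le (by positivity) ha
  have h1 : Y / a ≤ M₁ ^ 2 / m₁ := by
    rw [div_le_div_iff₀ ha0 hm]
    nlinarith [sq_nonneg M₁]
  have h2 : S / a ≤ q / m₁ := by
    rw [div_le_div_iff₀ ha0 hm, hS]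
    nlinarith
  have hqc : q ≤ p * c := by rw [hq]; nlinarith [mul_pos hp hc]
  have h3 : |X| ≤ M₁ * p * c * Z := by
    apply abs_le_of_sq_le_sq _ (by positivity)
    calc X ^ 2 ≤ Y * (p * S) := hX
      _ ≤ M₁ ^ 2 * Z * (p * S) := by gcongr
      _ = _ := by rw [hS, hq]; ring
  have h4 : -(X / a) ≤ M₁ / m₁ * (p * c) := by
    rw [← neg_div, div_mul_eq_mul_div, div_le_div_iff₀ ha0 hm]
    have h5 := neg_abs_le X
    have h6 : -X ≤ M₁ * p * c * Z := by linarith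
    calc -X * m₁ ≤ M₁ * p * c * Z * m₁ := by gcongr
      _ = M₁ * (p * c) * (m₁ * Z) := by ring
      _ ≤ _ := by gcongr
  have h5 : Real.log (S / a) ≤ Real.log q - Real.log m₁ := by
    rw [← Real.log_div hq0.ne' hm.ne']
    exact Real.log_le_log (by positivity) h2
  have h6 : Real.log q = Real.log (q / p) + Real.log p := by
    rw [Real.log_div hq0.ne' hp.ne']; ring
  have h7 := Real.log_le_half_mul_add hε hp
  have h8 : Y / a * (1 + φ * (S / a)) ≤ M₁ ^ 2 / m₁ * (1 + 1 * (p * c / m₁)) := by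
    have : S / a ≤ p * c / m₁ := h2.trans (by gcongr)
    gcongr
    linarith
  have h9 : -(2 * φ * (X / a)) ≤ 2 * (M₁ / m₁ * (p * c)) := by
    have : φ * (-(X / a)) ≤ φ * (M₁ / m₁ * (p * c)) := by gcongr
    have h10 : φ * (M₁ / m₁ * (p * c)) ≤ 1 * (M₁ / m₁ * (p * c)) := by
      gcongr; linarith
    linarith
  have h11 : M₁ ^ 2 / m₁ * (1 + 1 * (p * c / m₁)) + 2 * (M₁ / m₁ * (p * c)) =
      M₁ ^ 2 / m₁ + p * (c * (M₁ ^ 2 / m₁ ^ 2 + 2 * M₁ / m₁)) := by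
    field_simp
    ring
  have h12 : p * (c * (M₁ ^ 2 / m₁ ^ 2 + 2 * M₁ / m₁)) ≤ p * (ε / 2) := by gcongr
  have h13 : -(1 - φ) * p ≤ -ε * p := by nlinarith
  linarith

lemma Real.le_two_mul_sub_log {p : ℝ} (hp : 0 < p) : p ≤ 2 * (p - 1 - Real.log p) + 2 := by
  have h3 := Real.log_le_sub_one_of_pos (show 0 < p / 2 by positivity)
  rw [Real.log_div hp.ne' (by norm_num)] at h3
  have := Real.log_two_lt_d9
  linarith

/-- An upper bound for the increment of the potential when `‖y - s‖ ≤ e ‖s‖`, in the notation of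
`coarse_increment_le`. For `e = 0` the increment is at most
`-(1 - φ) (p - 1 - log p) - φ (q - 1 - log q) + (1 - φ) log (q / p)`, a sum of nonpositive terms.
The perturbation is `O(e p)`, which is absorbed because `p ≤ 2 (p - 1 - log p) + 2`. -/
lemma sharp_increment_le {ε e φ p q a Y X Z S : ℝ} (hε : 0 < ε)
    (hφ : 0 ≤ φ) (hφε : φ ≤ 1 - ε) (he : 0 ≤ e) (heε : 24 * e ≤ ε) (hp : 0 < p) (hq : 0 < q)
    (hqp : q ≤ p) (hZ : 0 < Z) (hS : S = q * Z) (ha : (1 - e) * Z ≤ a) (ha' : a ≤ (1 + e) * Z)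
    (hY : Y ≤ (1 + e) * a) (hX : S - e * (p * Z) ≤ X) :
    -(1 - φ) * p + Y / a * (1 + φ * (S / a)) - 2 * φ * (X / a) + Real.log (S / a) ≤
      15 * e - ε / 2 * ((p - 1 - Real.log p) - Real.log (q / p)) := by
  have he2 : e ≤ 1 / 24 := by linarith
  have hS0 : 0 < S := by rw [hS]; positivity
  have ha0 : 0 < a := lt_of_lt_of_le (by nlinarith) ha
  have h1 : Y / a ≤ 1 + e := (div_le_iff₀ ha0).2 hY
  have h2 : S / a ≤ q / (1 - e) := by
    rw [div_le_div_iff₀ ha0 (by linarith), hS]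
    nlinarith
  have h2' : (1 - e) * q ≤ S / a := by
    rw [le_div_iff₀ ha0, hS]
    have : (1 - e) * q * a ≤ (1 - e) * q * ((1 + e) * Z) := by
      apply mul_le_mul_of_nonneg_left ha'
      exact mul_nonneg (by linarith) hq.le
    nlinarith [mul_pos hq hZ, sq_nonneg e]
  have h3 : e * (p * Z) / a ≤ 2 * e * p := by
    rw [div_le_iff₀ ha0]
    have : e * p * Z ≤ e * p * (2 * a) := by
      gcongr; nlinarith
    linarith
  have h4 : Real.log (S / a) ≤ Real.log q + 2 * e := by
    have h5 : Real.log (S / a) ≤ Real.log (q / (1 - e)) := Real.log_le_log (by positivity) h2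
    have h6 : Real.log (1 - e)⁻¹ ≤ (1 - e)⁻¹ - 1 :=
      Real.log_le_sub_one_of_pos (inv_pos.2 (by linarith))
    have h7 : (1 - e)⁻¹ ≤ 1 + 2 * e := by
      rw [inv_le_iff_one_le_mul₀ (by linarith)]
      nlinarith
    rw [div_eq_mul_inv q, Real.log_mul hq.ne' (inv_pos.2 (by linarith)).ne'] at h5
    linarith
  have h5 : S / a - 2 * e * p ≤ X / a := by
    have := div_le_div_of_nonneg_right hX ha0.le
    rw [sub_div] at this
    linarith
  have h6 : Y / a * (1 + φ * (S / a)) ≤ (1 + e) * (1 + φ * (S / a)) := by gcongr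
  have h7 : φ * (S / a - 2 * e * p) ≤ φ * (X / a) := by gcongr
  have h8 : φ * ((1 - e) * ((1 - e) * q)) ≤ φ * ((1 - e) * (S / a)) := by
    apply mul_le_mul_of_nonneg_left _ hφ
    apply mul_le_mul_of_nonneg_left h2'
    linarith
  have hφ1 : φ ≤ 1 := by linarith
  have h9 : φ * (e * q) ≤ e * p := by
    have h91 : e * q ≤ e * p := by gcongr
    have h92 : φ * (e * q) ≤ 1 * (e * q) := by gcongr
    linarith
  have h10 : φ * (e * p) ≤ e * p := by
    have h92 : φ * (e * p) ≤ 1 * (e * p) := by gcongr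
    linarith
  have h11 : 0 ≤ φ * (e ^ 2 * q) := by positivity
  have h12 : -(1 - φ) * p + Y / a * (1 + φ * (S / a)) - 2 * φ * (X / a) + Real.log (S / a) ≤
      1 + 3 * e - (1 - φ) * p - φ * q + 6 * (e * p) + Real.log q := by
    nlinarith
  have h13 : 0 ≤ φ * (q - 1 - Real.log q) := by
    have := Real.log_le_sub_one_of_pos hq
    exact mul_nonneg hφ (by linarith)
  have h14 := Real.log_le_sub_one_of_pos hp
  have h15 : Real.log (q / p) ≤ 0 := Real.log_nonpos (by positivity) ((div_le_one hp).2 hqp)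
  have h16 : ε * ((p - 1 - Real.log p) - Real.log (q / p)) ≤
      (1 - φ) * ((p - 1 - Real.log p) - Real.log (q / p)) :=
    mul_le_mul_of_nonneg_right (by linarith) (by linarith)
  have h17 : e * p ≤ e * (2 * (p - 1 - Real.log p) + 2) :=
    mul_le_mul_of_nonneg_left (Real.le_two_mul_sub_log hp) he
  have h18 : 24 * e * (p - 1 - Real.log p) ≤ ε * (p - 1 - Real.log p) :=
    mul_le_mul_of_nonneg_right heε (by linarith)
  have h19 : ε * Real.log (q / p) ≤ 0 := mul_nonpos_of_nonneg_of_nonpos hε.le h15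
  rw [Real.log_div hq.ne' hp.ne'] at h15 h16 h19 ⊢
  nlinarith

section Potential

variable {n : ℕ}

/-- The potential drops by about `|log (cosSq B s)|` when `s` and `B s` are nearly orthogonal. -/
lemma exists_updatePotential_le_add_log_cosSq {m₁ M₁ ε : ℝ} (hm : 0 < m₁) (hM : 0 < M₁)
    (hε : 0 < ε) : ∃ C γ : ℝ, 0 < γ ∧ ∀ (B : Matrix (Fin n) (Fin n) ℝ) (φ : ℝ) (s y : Fin n → ℝ),
      B.PosDef → 0 ≤ φ → φ ≤ 1 - ε → s ≠ 0 → m₁ * (s ⬝ᵥ s) ≤ y ⬝ᵥ s →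
      y ⬝ᵥ y ≤ M₁ ^ 2 * (s ⬝ᵥ s) → cosSq B s ≤ γ →
      updatePotential (broydenHessianUpdate φ B s y) ≤
        updatePotential B + C + Real.log (cosSq B s) := by
  set A := M₁ ^ 2 / m₁ ^ 2 + 2 * M₁ / m₁ with hA
  have hA0 : 0 < A := by positivity
  refine ⟨M₁ ^ 2 / m₁ - Real.log m₁ + Real.log (2 / ε), (ε / 2 / A) ^ 2, by positivity, ?_⟩
  intro B φ s y hB hφ hφε hs ha hY hγ
  have hp := imageQuotient_pos hB hs
  have hq := rayleighQuotient_pos hB hs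
  have hc := cosSq_pos hB hs
  have hS := dotProduct_mulVec_self_pos hB hs
  have hZ := dotProduct_self_pos hs
  have h := coarse_increment_le (p := imageQuotient B s) (q := rayleighQuotient B s)
    (c := Real.sqrt (cosSq B s)) (X := y ⬝ᵥ (B *ᵥ s)) (S := s ⬝ᵥ (B *ᵥ s)) hm hM hε hφ hφε hp
    (Real.sqrt_pos.2 hc) (Real.sqrt_le_one.2 (cosSq_le_one hB hs)) ?_ hZ ?_ ha hY ?_ ?_
  · have h2 := updatePotential_broydenHessianUpdate_le hB hφ hS (lt_of_lt_of_le (by positivity) ha)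
    rw [cosSq]
    linarith
  · rw [Real.sq_sqrt hc.le, cosSq]; field_simp
  · rw [rayleighQuotient]; field_simp
  · have := sq_dotProduct_le y (B *ᵥ s)
    rw [imageQuotient]; field_simp; exact this
  · rw [← hA, ← le_div_iff₀ hA0]
    exact Real.sqrt_le_iff.2 ⟨by positivity, hγ⟩

/-- When `y` is close to `s`, the potential increases by at most a multiple of the relative error
`e`, and it drops unless `B s` is close to `s`. -/
lemma updatePotential_le_of_near {ε : ℝ} (hε : 0 < ε) {B : Matrix (Fin n) (Fin n) ℝ}
    {φ e : ℝ} {s y : Fin n → ℝ} (hB : B.PosDef) (hφ : 0 ≤ φ) (hφε : φ ≤ 1 - ε) (hs : s ≠ 0)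
    (he : 0 ≤ e) (heε : 24 * e ≤ ε) (hy : (y - s) ⬝ᵥ (y - s) ≤ e ^ 2 * (s ⬝ᵥ s)) :
    updatePotential (broydenHessianUpdate φ B s y) ≤ updatePotential B + 15 * e
      - ε / 2 * ((imageQuotient B s - 1 - Real.log (imageQuotient B s))
        - Real.log (cosSq B s)) := by
  have hp := imageQuotient_pos hB hs
  have hq := rayleighQuotient_pos hB hs
  have hc := cosSq_pos hB hs
  have hS := dotProduct_mulVec_self_pos hB hs
  have hZ := dotProduct_self_pos hs
  have he1 : e ≤ 1 / 24 := by linarith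
  have h1 : |(y - s) ⬝ᵥ s| ≤ e * (s ⬝ᵥ s) := by
    apply abs_le_of_sq_le_sq _ (by positivity)
    calc _ ≤ _ := sq_dotProduct_le (y - s) s
      _ ≤ e ^ 2 * (s ⬝ᵥ s) * (s ⬝ᵥ s) := by gcongr
      _ = _ := by ring
  have h2 : (B *ᵥ s) ⬝ᵥ (B *ᵥ s) = imageQuotient B s * rayleighQuotient B s * (s ⬝ᵥ s) := by
    rw [imageQuotient, rayleighQuotient]; field_simp
  have h3 : |(y - s) ⬝ᵥ (B *ᵥ s)| ≤ e * (imageQuotient B s * (s ⬝ᵥ s)) := by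
    apply abs_le_of_sq_le_sq _ (by positivity)
    calc _ ≤ _ := sq_dotProduct_le (y - s) (B *ᵥ s)
      _ ≤ e ^ 2 * (s ⬝ᵥ s) * (imageQuotient B s * rayleighQuotient B s * (s ⬝ᵥ s)) := by
        rw [h2]; gcongr
      _ ≤ e ^ 2 * (s ⬝ᵥ s) * (imageQuotient B s * imageQuotient B s * (s ⬝ᵥ s)) := by
        gcongr; exact rayleighQuotient_le_imageQuotient hB hs
      _ = _ := by ring
  have h4 : (y - s) ⬝ᵥ (y - s) = y ⬝ᵥ y - 2 * (y ⬝ᵥ s) + s ⬝ᵥ s := by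
    simp only [dotProduct_sub, sub_dotProduct, dotProduct_comm s y]; ring
  rw [sub_dotProduct] at h1 h3
  have h5 := abs_le.1 h1
  have h6 := abs_le.1 h3
  have h := sharp_increment_le (p := imageQuotient B s) (q := rayleighQuotient B s)
    (X := y ⬝ᵥ (B *ᵥ s)) (S := s ⬝ᵥ (B *ᵥ s)) (Z := s ⬝ᵥ s) (a := y ⬝ᵥ s) (Y := y ⬝ᵥ y)
    hε hφ hφε he heε hp hq (rayleighQuotient_le_imageQuotient hB hs) hZ ?_ (by linarith)
    (by linarith) (by nlinarith) (by linarith)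
  · have h2 := updatePotential_broydenHessianUpdate_le hB hφ hS (y := y) (by nlinarith)
    rw [cosSq]
    linarith
  · rw [rayleighQuotient]; field_simp

end Potential

/-! ### Sequences governed by a potential -/

section Sequences

/-- Global convergence. If `F` stayed away from zero, the decrease would force the squared cosines
`c k` to tend to zero, and the nonnegative potential `ψ` would tend to `-∞`. -/
lemma tendsto_zero_of_decrease_of_potential {F c ψ : ℕ → ℝ} {κ C γ : ℝ} (hκ : 0 < κ) (hγ : 0 < γ)
    (hF : ∀ k, 0 ≤ F k) (hc : ∀ k, 0 < c k) (hdec : ∀ k, F (k + 1) ≤ F k - κ * c k * F k)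
    (hψ : ∀ k, 0 ≤ ψ k) (hstep : ∀ k, c k ≤ γ → ψ (k + 1) ≤ ψ k + C + Real.log (c k)) :
    Tendsto F atTop (𝓝 0) := by
  have hanti : Antitone F := antitone_nat_of_succ_le fun k => by
    have := mul_nonneg (mul_nonneg hκ.le (hc k).le) (hF k)
    linarith [hdec k]
  have hbdd : BddBelow (Set.range F) := ⟨0, by rintro _ ⟨k, rfl⟩; exact hF k⟩
  have hlim := tendsto_atTop_ciInf hanti hbdd
  set l := ⨅ k, F k with hl
  have hl0 : 0 ≤ l := le_ciInf hF
  rcases hl0.eq_or_lt with h | h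
  · rwa [← h] at hlim
  exfalso
  have hle : ∀ k, l ≤ F k := fun k => ciInf_le hbdd k
  have hc0 : Tendsto c atTop (𝓝 0) := by
    have h1 : Tendsto (fun k => (F k - F (k + 1)) / (κ * l)) atTop (𝓝 0) := by
      have := (hlim.sub (hlim.comp (tendsto_add_atTop_nat 1))).div_const (κ * l)
      simpa using this
    refine squeeze_zero (fun k => (hc k).le) (fun k => ?_) h1
    rw [le_div_iff₀ (by positivity)]
    have : κ * c k * l ≤ κ * c k * F k := by
      have := hc k
      have := hle k
      gcongr
    linarith [hdec k]
  have hc1 : Tendsto c atTop (𝓝[≠] 0) :=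
    tendsto_nhdsWithin_iff.2 ⟨hc0, Eventually.of_forall fun k => (hc k).ne'⟩
  have hlog := Real.tendsto_log_nhdsNE_zero.comp hc1
  have hev : ∀ᶠ k in atTop, ψ (k + 1) ≤ ψ k - 1 := by
    filter_upwards [hlog.eventually_le_atBot (-1 - C), hc0.eventually_le_const hγ] with k h1 h2
    have := hstep k h2
    simp only [Function.comp_apply] at h1
    linarith
  obtain ⟨K, hK⟩ := eventually_atTop.1 hev
  have hind : ∀ j : ℕ, ψ (K + j) ≤ ψ K - j := by
    intro j
    induction j with
    | zero => simp
    | succ j ih =>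
      have := hK (K + j) (by omega)
      push_cast
      rw [← add_assoc]
      linarith
  obtain ⟨j, hj⟩ := exists_nat_gt (ψ K)
  linarith [hind j, hψ (K + j)]

lemma le_mul_exp_neg_sum {F c : ℕ → ℝ} {κ : ℝ} (hF : ∀ k, 0 ≤ F k)
    (hdec : ∀ k, F (k + 1) ≤ F k - κ * c k * F k) (N : ℕ) :
    F N ≤ F 0 * Real.exp (-κ * ∑ k ∈ Finset.range N, c k) := by
  induction N with
  | zero => simp
  | succ N ih =>
    rw [Finset.sum_range_succ, mul_add, Real.exp_add, ← mul_assoc]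
    have h1 := Real.add_one_le_exp (-κ * c N)
    calc F (N + 1) ≤ F N * (-κ * c N + 1) := by linarith [hdec N]
      _ ≤ F N * Real.exp (-κ * c N) := mul_le_mul_of_nonneg_left h1 (hF N)
      _ ≤ _ := by gcongr

/-- A lower bound for the mean of `log c k` makes the sum of the `c k` grow linearly, hence `F`
decays geometrically; the errors `e k` are then summable, and the nonnegative terms by which the
potential decreases are summable as well. -/
lemma tendsto_zero_of_potential_decrease {F c ψ e h : ℕ → ℝ} {κ ε A E : ℝ} (hκ : 0 < κ)
    (hε : 0 < ε) (hA : 0 ≤ A) (hF : ∀ k, 0 ≤ F k) (hc : ∀ k, 0 < c k) (hc1 : ∀ k, c k ≤ 1)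
    (hdec : ∀ k, F (k + 1) ≤ F k - κ * c k * F k) (hψ : ∀ k, 0 ≤ ψ k) (hh : ∀ k, 0 ≤ h k)
    (he : ∀ k, 0 ≤ e k) (heE : ∀ k, e k ≤ E) (heF : ∀ k, e k ≤ A * Real.sqrt (F k))
    (hstep : ∀ k, ψ (k + 1) ≤ ψ k + 15 * e k - ε * (h k - Real.log (c k))) :
    Tendsto h atTop (𝓝 0) ∧ Tendsto (fun k => Real.log (c k)) atTop (𝓝 0) := by
  have hlog : ∀ k, Real.log (c k) ≤ 0 := fun k => Real.log_nonpos (hc k).le (hc1 k)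
  have hsum : ∀ N, ε * ∑ k ∈ Finset.range N, (h k - Real.log (c k)) ≤
      ψ 0 - ψ N + 15 * ∑ k ∈ Finset.range N, e k := by
    intro N
    induction N with
    | zero => simp
    | succ N ih =>
      rw [Finset.sum_range_succ, Finset.sum_range_succ, mul_add, mul_add]
      linarith [hstep N]
  set C := 15 * E / ε with hC
  have hsumc : ∀ N : ℕ, Real.exp (-C) * (N - ψ 0 / ε) ≤ ∑ k ∈ Finset.range N, c k := by
    intro N
    have h1 : ∀ k, Real.exp (-C) * (1 + Real.log (c k) + C) ≤ c k := by
      intro k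
      have h2 := Real.add_one_le_exp (Real.log (c k) + C)
      -- The tangent to `exp` at `-C` replaces the arithmetic-geometric mean inequality.
      calc _ ≤ Real.exp (-C) * Real.exp (Real.log (c k) + C) := by
            gcongr; linarith
        _ = c k := by rw [← Real.exp_add]; simp [Real.exp_log (hc k)]
    refine le_trans ?_ (Finset.sum_le_sum fun k _ => h1 k)
    rw [← Finset.mul_sum]
    gcongr
    have h3 : ∑ k ∈ Finset.range N, e k ≤ N * E := by
      have := Finset.sum_le_card_nsmul (Finset.range N) e E (fun k _ => heE k)
      simpa using this
    have h4 : ∑ k ∈ Finset.range N, (-Real.log (c k)) ≤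
        ∑ k ∈ Finset.range N, (h k - Real.log (c k)) :=
      Finset.sum_le_sum fun k _ => by linarith [hh k]
    have h5 : ε * ∑ k ∈ Finset.range N, (-Real.log (c k)) ≤ ψ 0 + 15 * (N * E) := by
      have := mul_le_mul_of_nonneg_left h4 hε.le
      linarith [hsum N, hψ N]
    rw [Finset.sum_neg_distrib] at h5
    simp only [Finset.sum_add_distrib, Finset.sum_const, Finset.card_range, nsmul_eq_mul, mul_one]
    have h6 : - (∑ k ∈ Finset.range N, Real.log (c k)) ≤ ψ 0 / ε + N * C := by
      rw [hC, show ψ 0 / ε + N * (15 * E / ε) = (ψ 0 + 15 * (N * E)) / ε by ring,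
        le_div_iff₀ hε]
      linarith
    linarith
  set σ := κ * Real.exp (-C) with hσ
  have hσ0 : 0 < σ := by positivity
  have hFexp : ∀ N : ℕ, F N ≤ F 0 * Real.exp (σ * (ψ 0 / ε)) * Real.exp (-σ * N) := by
    intro N
    refine (le_mul_exp_neg_sum hF hdec N).trans ?_
    rw [mul_assoc, ← Real.exp_add]
    refine mul_le_mul_of_nonneg_left (Real.exp_le_exp.2 ?_) (hF 0)
    have := mul_le_mul_of_nonneg_left (hsumc N) hκ.le
    rw [hσ]
    linarith
  have hes : Summable e := by
    have hg : Summable fun N : ℕ => A * Real.sqrt (F 0 * Real.exp (σ * (ψ 0 / ε))) *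
        Real.exp (N * (-σ / 2)) :=
      (Real.summable_exp_nat_mul_iff.2 (by linarith : -σ / 2 < 0)).mul_left _
    refine Summable.of_nonneg_of_le he (fun N => (heF N).trans ?_) hg
    rw [mul_assoc]
    refine mul_le_mul_of_nonneg_left ?_ hA
    refine Real.sqrt_le_iff.2 ⟨by positivity, ?_⟩
    have h0 : 0 ≤ F 0 * Real.exp (σ * (ψ 0 / ε)) := mul_nonneg (hF 0) (Real.exp_pos _).le
    rw [mul_pow, Real.sq_sqrt h0, ← Real.exp_nat_mul]
    refine (hFexp N).trans (le_of_eq ?_)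
    congr 2
    push_cast
    ring
  have hD : Summable fun k => h k - Real.log (c k) := by
    refine summable_of_sum_range_le (c := (ψ 0 + 15 * ∑' k, e k) / ε)
      (fun k => by linarith [hh k, hlog k]) fun N => ?_
    rw [le_div_iff₀ hε]
    have := hes.sum_le_tsum (Finset.range N) fun k _ => he k
    linarith [hsum N, hψ N]
  have hD0 := hD.tendsto_atTop_zero
  refine ⟨squeeze_zero hh (fun k => by linarith [hlog k]) hD0, ?_⟩
  have : Tendsto (fun k => -Real.log (c k)) atTop (𝓝 0) :=
    squeeze_zero (fun k => by linarith [hlog k]) (fun k => by linarith [hh k]) hD0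
  simpa using this.neg

lemma tendsto_one_of_sub_log {p : ℕ → ℝ} (hp : ∀ k, 0 < p k)
    (h : Tendsto (fun k => p k - 1 - Real.log (p k)) atTop (𝓝 0)) : Tendsto p atTop (𝓝 1) := by
  have h1 : Tendsto (fun k => (Real.sqrt (p k) - 1) ^ 2) atTop (𝓝 0) := by
    refine squeeze_zero (fun k => sq_nonneg _) (fun k => ?_) h
    -- `log p = 2 log √p ≤ 2 (√p - 1)` gives `(√p - 1)² ≤ p - 1 - log p`.
    have h2 := Real.log_le_sub_one_of_pos (Real.sqrt_pos.2 (hp k))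
    rw [Real.log_sqrt (hp k).le] at h2
    nlinarith [Real.sq_sqrt (hp k).le]
  have h2 : Tendsto (fun k => Real.sqrt (p k) - 1) atTop (𝓝 0) := by
    have := (Real.continuous_sqrt.tendsto 0).comp h1
    simp only [Function.comp_def, Real.sqrt_sq_eq_abs, Real.sqrt_zero] at this
    exact (tendsto_zero_iff_abs_tendsto_zero _).2 this
  have h3 : Tendsto (fun k => (Real.sqrt (p k) - 1 + 1) ^ 2) atTop (𝓝 ((0 + 1) ^ 2)) :=
    (h2.add_const 1).pow 2
  simpa [Real.sq_sqrt (hp _).le] using h3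

end Sequences

/-! ### Self-concordance along a line -/

section OneVariable

lemma image_sub_le_image_sub_of_deriv_le {u w u' w' : ℝ → ℝ} {T : ℝ} (hT : 0 ≤ T)
    (hu : ∀ τ ∈ Set.Icc 0 T, HasDerivAt u (u' τ) τ)
    (hw : ∀ τ ∈ Set.Icc 0 T, HasDerivAt w (w' τ) τ)
    (h : ∀ τ ∈ Set.Icc 0 T, u' τ ≤ w' τ) : u T - u 0 ≤ w T - w 0 := by
  have hd : ∀ τ ∈ Set.Icc 0 T, HasDerivAt (fun τ => w τ - u τ) (w' τ - u' τ) τ :=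
    fun τ hτ => (hw τ hτ).sub (hu τ hτ)
  have hmono : MonotoneOn (fun τ => w τ - u τ) (Set.Icc 0 T) := by
    refine monotoneOn_of_deriv_nonneg (convex_Icc 0 T)
      (fun τ hτ => (hd τ hτ).continuousAt.continuousWithinAt)
      (fun τ hτ => (hd τ (interior_subset hτ)).differentiableAt.differentiableWithinAt)
      fun τ hτ => ?_
    rw [(hd τ (interior_subset hτ)).deriv]
    linarith [h τ (interior_subset hτ)]
  have := hmono (Set.left_mem_Icc.2 hT) (Set.right_mem_Icc.2 hT) hT
  linarith

/-- The function `u^(-1/2)` is 1-Lipschitz if `|u'| ≤ 2 u^(3/2)` and `u` is positive. -/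
lemma abs_inv_sqrt_sub_le {u u' : ℝ → ℝ} {T : ℝ} (hT : 0 ≤ T)
    (hu : ∀ τ ∈ Set.Icc 0 T, HasDerivAt u (u' τ) τ) (hpos : ∀ τ ∈ Set.Icc 0 T, 0 < u τ)
    (h : ∀ τ ∈ Set.Icc 0 T, |u' τ| ≤ 2 * Real.sqrt (u τ) ^ 3) :
    |(Real.sqrt (u T))⁻¹ - (Real.sqrt (u 0))⁻¹| ≤ T := by
  have hd : ∀ τ ∈ Set.Icc 0 T, HasDerivWithinAt (fun τ => (Real.sqrt (u τ))⁻¹)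
      (-(u' τ / (2 * Real.sqrt (u τ))) / Real.sqrt (u τ) ^ 2) (Set.Icc 0 T) τ := fun τ hτ =>
    (((hu τ hτ).sqrt (hpos τ hτ).ne').fun_inv (Real.sqrt_pos.2 (hpos τ hτ)).ne').hasDerivWithinAt
  have := (convex_Icc 0 T).norm_image_sub_le_of_norm_hasDerivWithin_le hd (C := 1) ?_
    (Set.left_mem_Icc.2 hT) (Set.right_mem_Icc.2 hT)
  · simpa [abs_of_nonneg hT] using this
  · intro τ hτ
    have hs := Real.sqrt_pos.2 (hpos τ hτ)
    rw [Real.norm_eq_abs, abs_div, abs_neg, abs_div, abs_of_pos (by positivity : 0 < 2 * √(u τ)),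
      abs_of_pos (by positivity : 0 < √(u τ) ^ 2), div_div, div_le_one (by positivity)]
    linarith [h τ hτ]

/-- Growth of the second derivative `v` of a self-concordant function along a line. -/
lemma sqrt_bounds_of_abs_deriv_le {v v' : ℝ → ℝ} {T : ℝ} (hT : 0 ≤ T)
    (hv : ∀ τ, HasDerivAt v (v' τ) τ) (hnn : ∀ τ, 0 ≤ v τ) (h0 : 0 < v 0)
    (h : ∀ τ, |v' τ| ≤ 2 * Real.sqrt (v τ) ^ 3) :
    (Real.sqrt (v 0) / (1 + T * Real.sqrt (v 0))) ^ 2 ≤ v T ∧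
      (T * Real.sqrt (v 0) < 1 →
        v T ≤ (Real.sqrt (v 0) / (1 - T * Real.sqrt (v 0))) ^ 2) := by
  have hr := Real.sqrt_pos.2 h0
  have key : ∀ T, 0 ≤ T → (Real.sqrt (v 0) / (1 + T * Real.sqrt (v 0))) ^ 2 ≤ v T := by
    intro T hT
    refine le_of_forall_pos_le_add fun ε hε => ?_
    -- Adding `ε` keeps `v` away from zero, so that `(v + ε)^(-1/2)` is 1-Lipschitz.
    have h1 := abs_inv_sqrt_sub_le (u := fun τ => v τ + ε) hT (fun τ _ => (hv τ).add_const ε)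
      (fun τ _ => by linarith [hnn τ]) (fun τ _ => (h τ).trans (by
        have : Real.sqrt (v τ) ≤ Real.sqrt (v τ + ε) := Real.sqrt_le_sqrt (by linarith)
        gcongr))
    have h2 : (Real.sqrt (v 0 + ε))⁻¹ ≤ (Real.sqrt (v 0))⁻¹ := by
      gcongr; linarith
    have h3 := (abs_le.1 h1).2
    have h4 : 0 < Real.sqrt (v T + ε) := Real.sqrt_pos.2 (by linarith [hnn T])
    have h5 : (Real.sqrt (v T + ε))⁻¹ ≤ (1 + T * Real.sqrt (v 0)) / Real.sqrt (v 0) := by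
      rw [add_div, mul_div_assoc, div_self hr.ne', one_div]
      linarith
    have h6 : Real.sqrt (v 0) / (1 + T * Real.sqrt (v 0)) ≤ Real.sqrt (v T + ε) := by
      rw [inv_le_comm₀ h4 (by positivity), inv_div] at h5
      exact h5
    calc _ ≤ Real.sqrt (v T + ε) ^ 2 := by gcongr
      _ = _ := Real.sq_sqrt (by linarith [hnn T])
  have hpos : ∀ τ, 0 ≤ τ → 0 < v τ := fun τ hτ => lt_of_lt_of_le (by positivity) (key τ hτ)
  refine ⟨key T hT, fun hT1 => ?_⟩
  have h1 := abs_inv_sqrt_sub_le hT (fun τ _ => hv τ) (fun τ hτ => hpos τ hτ.1) (fun τ _ => h τ)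
  have h3 := (abs_le.1 h1).1
  have h4 : 0 < Real.sqrt (v T) := Real.sqrt_pos.2 (hpos T hT)
  have h5 : (1 - T * Real.sqrt (v 0)) / Real.sqrt (v 0) ≤ (Real.sqrt (v T))⁻¹ := by
    rw [sub_div, mul_div_assoc, div_self hr.ne', one_div]
    linarith
  have h7 : 0 < (1 - T * Real.sqrt (v 0)) / Real.sqrt (v 0) := div_pos (by linarith) hr
  have h6 : Real.sqrt (v T) ≤ Real.sqrt (v 0) / (1 - T * Real.sqrt (v 0)) := by
    rw [le_inv_comm₀ h7 h4, inv_div] at h5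
    exact h5
  calc v T = Real.sqrt (v T) ^ 2 := (Real.sq_sqrt (hnn T)).symm
    _ ≤ _ := by gcongr

/-- Consequences of self-concordance for the step from `0` to `1` in one variable, when the second
derivative at `0` is `r²` and the first derivative there is `-r² / (1 - r)`: bounds for the change
of the derivative, and a decrease by at least half the initial slope. -/
lemma selfConcordant_step_one_variable {u u₁ v v' : ℝ → ℝ} {r : ℝ}
    (hu : ∀ τ, HasDerivAt u (u₁ τ) τ) (hu₁ : ∀ τ, HasDerivAt u₁ (v τ) τ)
    (hv : ∀ τ, HasDerivAt v (v' τ) τ) (hnn : ∀ τ, 0 ≤ v τ)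
    (h : ∀ τ, |v' τ| ≤ 2 * Real.sqrt (v τ) ^ 3) (hr : Real.sqrt (v 0) = r) (hr0 : 0 < r)
    (hr1 : r < 1) (hu0 : u₁ 0 = -(r ^ 2 / (1 - r))) :
    r ^ 2 / (1 + r) ≤ u₁ 1 - u₁ 0 ∧ u₁ 1 - u₁ 0 ≤ r ^ 2 / (1 - r) ∧
      u 1 ≤ u 0 - r ^ 2 / (1 - r) / 2 := by
  have h0 : 0 < v 0 := Real.sqrt_pos.1 (hr ▸ hr0)
  have hb := fun (τ : ℝ) (hτ : 0 ≤ τ) => sqrt_bounds_of_abs_deriv_le hτ hv hnn h0 h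
  rw [hr] at hb
  have hlow : ∀ τ ∈ Set.Icc (0 : ℝ) 1,
      HasDerivAt (fun τ => r ^ 2 * τ / (1 + τ * r)) ((r / (1 + τ * r)) ^ 2) τ := by
    intro τ hτ
    have hne : 1 + τ * r ≠ 0 := by have := mul_nonneg hτ.1 hr0.le; positivity
    have := ((hasDerivAt_id τ).const_mul (r ^ 2)).fun_div
      (((hasDerivAt_id τ).mul_const r).const_add 1) hne
    convert! this using 1
    simp only [id]
    field_simp
    ring
  have hupp : ∀ τ ∈ Set.Icc (0 : ℝ) 1,
      HasDerivAt (fun τ => r ^ 2 * τ / (1 - τ * r)) ((r / (1 - τ * r)) ^ 2) τ := by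
    intro τ hτ
    have hne : 1 - τ * r ≠ 0 := by have := hτ.2; nlinarith
    have := ((hasDerivAt_id τ).const_mul (r ^ 2)).fun_div
      (((hasDerivAt_id τ).mul_const r).const_sub 1) hne
    convert! this using 1
    simp only [id]
    field_simp
    ring
  have hup : ∀ T ∈ Set.Icc (0 : ℝ) 1, u₁ T - u₁ 0 ≤ r ^ 2 * T / (1 - T * r) := by
    intro T hT
    have := image_sub_le_image_sub_of_deriv_le hT.1 (fun τ _ => hu₁ τ)
      (fun τ hτ => hupp τ ⟨hτ.1, hτ.2.trans hT.2⟩)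
      (fun τ hτ => (hb τ hτ.1).2 (by have := hτ.2.trans hT.2; nlinarith))
    simpa using this
  refine ⟨?_, ?_, ?_⟩
  · have := image_sub_le_image_sub_of_deriv_le zero_le_one hlow (fun τ _ => hu₁ τ)
      (fun τ hτ => (hb τ hτ.1).1)
    simpa using this
  · simpa using hup 1 (by simp)
  · have hq : ∀ τ, HasDerivAt (fun τ => u₁ 0 * τ + r ^ 2 / (1 - r) * (τ ^ 2 / 2))
        (u₁ 0 + r ^ 2 / (1 - r) * τ) τ := by
      intro τ
      have := ((hasDerivAt_id τ).const_mul (u₁ 0)).fun_add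
        ((((hasDerivAt_id τ).pow 2).div_const 2).const_mul (r ^ 2 / (1 - r)))
      convert! this using 1
      simp
    -- On `[0, 1]` the derivative is at most `-(r² / (1 - r)) (1 - τ)`.
    have := image_sub_le_image_sub_of_deriv_le zero_le_one (fun τ _ => hu τ) (fun τ _ => hq τ)
      (fun τ hτ => by
        have h1 := hup τ hτ
        have h2 : r ^ 2 * τ / (1 - τ * r) ≤ r ^ 2 * τ / (1 - r) := by
          have := hτ.1
          have := mul_le_of_le_one_left hr0.le hτ.2
          gcongr
        have h3 : r ^ 2 * τ / (1 - r) = r ^ 2 / (1 - r) * τ := by ring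
        linarith)
    rw [hu0] at this
    norm_num at this
    linarith

end OneVariable

section Gradient

variable {n : ℕ} {f : EuclideanSpace ℝ (Fin n) → ℝ}

lemma inner_gradient (f : EuclideanSpace ℝ (Fin n) → ℝ) (x h : EuclideanSpace ℝ (Fin n)) :
    inner ℝ (gradient f x) h = fderiv ℝ f x h := by
  rw [gradient, InnerProductSpace.toDual_symm_apply]

lemma contDiff_gradient (hf : ContDiff ℝ 3 f) : ContDiff ℝ 2 (gradient f) := by
  have h : ContDiff ℝ 2 (fderiv ℝ f) := hf.fderiv_right (by norm_num)
  exact (InnerProductSpace.toDual ℝ (EuclideanSpace ℝ (Fin n))).symm.contDiff.comp h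

lemma hasDerivAt_line (x h : EuclideanSpace ℝ (Fin n)) (τ : ℝ) :
    HasDerivAt (fun τ : ℝ => x + τ • h) h τ := by
  simpa using ((hasDerivAt_id τ).smul_const h).const_add x

lemma hasDerivAt_comp_line (hf : ContDiff ℝ 3 f) (x h : EuclideanSpace ℝ (Fin n)) (τ : ℝ) :
    HasDerivAt (fun τ : ℝ => f (x + τ • h)) (inner ℝ (gradient f (x + τ • h)) h) τ := by
  rw [inner_gradient]
  exact ((hf.differentiable (by norm_num)) _).hasFDerivAt.comp_hasDerivAt τ (hasDerivAt_line x h τ)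

lemma inner_fderiv_gradient (hf : ContDiff ℝ 3 f) (x h k : EuclideanSpace ℝ (Fin n)) :
    inner ℝ (fderiv ℝ (gradient f) x h) k = fderiv ℝ (fderiv ℝ f) x h k := by
  have h1 : DifferentiableAt ℝ (gradient f) x :=
    (contDiff_gradient hf).differentiable (by norm_num) x
  have h2 : DifferentiableAt ℝ (fderiv ℝ f) x :=
    (hf.fderiv_right (m := 2) (by norm_num)).differentiable (by norm_num) x
  have h3 : (fun z => inner ℝ (gradient f z) k) = fun z => fderiv ℝ f z k :=
    funext fun z => inner_gradient f z k
  have h4 := (h1.hasFDerivAt.inner ℝ (hasFDerivAt_const k x)).fderiv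
  have h5 := (h2.hasFDerivAt.clm_apply (hasFDerivAt_const k x)).fderiv
  rw [h3, h5] at h4
  have := congrArg (fun L => L h) h4
  simpa using this.symm

lemma inner_fderiv_gradient_self (hf : ContDiff ℝ 3 f) (x h : EuclideanSpace ℝ (Fin n)) :
    inner ℝ (fderiv ℝ (gradient f) x h) h = iteratedFDeriv ℝ 2 f x ![h, h] := by
  rw [inner_fderiv_gradient hf, iteratedFDeriv_two_apply]
  simp

lemma inner_fderiv_gradient_comm (hf : ContDiff ℝ 3 f) (x h k : EuclideanSpace ℝ (Fin n)) :
    inner ℝ (fderiv ℝ (gradient f) x h) k = inner ℝ h (fderiv ℝ (gradient f) x k) := by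
  rw [real_inner_comm _ h, inner_fderiv_gradient hf, inner_fderiv_gradient hf]
  exact (hf.contDiffAt.isSymmSndFDerivAt (by simp; norm_num)) h k

lemma hasDerivAt_inner_gradient_line (hf : ContDiff ℝ 3 f) (x h : EuclideanSpace ℝ (Fin n))
    (τ : ℝ) : HasDerivAt (fun τ : ℝ => inner ℝ (gradient f (x + τ • h)) h)
      (iteratedFDeriv ℝ 2 f (x + τ • h) ![h, h]) τ := by
  have h1 : DifferentiableAt ℝ (gradient f) (x + τ • h) :=
    (contDiff_gradient hf).differentiable (by norm_num) _
  have h2 := h1.hasFDerivAt.comp_hasDerivAt τ (hasDerivAt_line x h τ)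
  have h3 := h2.inner ℝ (hasDerivAt_const τ h)
  rw [← inner_fderiv_gradient_self hf]
  simpa using h3

lemma hasDerivAt_iteratedFDeriv_two_line (hf : ContDiff ℝ 3 f) (x h : EuclideanSpace ℝ (Fin n))
    (τ : ℝ) : HasDerivAt (fun τ : ℝ => iteratedFDeriv ℝ 2 f (x + τ • h) ![h, h])
      (iteratedFDeriv ℝ 3 f (x + τ • h) ![h, h, h]) τ := by
  have h1 : DifferentiableAt ℝ (iteratedFDeriv ℝ 2 f) (x + τ • h) :=
    hf.differentiable_iteratedFDeriv (by norm_num) _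
  have h2 := h1.hasFDerivAt.comp_hasDerivAt τ (hasDerivAt_line x h τ)
  have h3 := (ContinuousMultilinearMap.apply ℝ (fun _ : Fin 2 => EuclideanSpace ℝ (Fin n)) ℝ
    ![h, h]).hasFDerivAt.comp_hasDerivAt τ h2
  exact h3

lemma StandardSelfConcordant.iteratedFDeriv_two_nonneg (hf : StandardSelfConcordant f)
    (x h : EuclideanSpace ℝ (Fin n)) : 0 ≤ iteratedFDeriv ℝ 2 f x ![h, h] := by
  have h1 : ConvexOn ℝ Set.univ (fun τ : ℝ => f (x + τ • h)) := by
    have := hf.convex.comp_affineMap (AffineMap.lineMap x (x + h))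
    simpa [Function.comp_def, AffineMap.lineMap_apply, add_comm] using this
  have h2 : deriv (fun τ : ℝ => f (x + τ • h)) = fun τ => inner ℝ (gradient f (x + τ • h)) h :=
    funext fun τ => (hasDerivAt_comp_line hf.contDiff x h τ).deriv
  have h3 : Monotone fun τ : ℝ => inner ℝ (gradient f (x + τ • h)) h := by
    rw [← h2, ← monotoneOn_univ]
    exact h1.monotoneOn_deriv fun τ _ =>
      (hasDerivAt_comp_line hf.contDiff x h τ).differentiableAt
  have h4 := h3.deriv_nonneg (x := 0)
  rw [(hasDerivAt_inner_gradient_line hf.contDiff x h 0).deriv] at h4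
  simpa using h4

/-- A step `s` of local norm `r < 1` and slope `-r² / (1 - r)` satisfies the Wolfe conditions: it
decreases `f` by at least half the absolute slope, and `yᵀ s` is comparable to that slope, where `y`
is the change of the gradient. -/
lemma StandardSelfConcordant.step (hf : StandardSelfConcordant f)
    {x s : EuclideanSpace ℝ (Fin n)} {r : ℝ} (hr : localNorm f x s = r) (hr0 : 0 < r)
    (hr1 : r < 1) (hs : inner ℝ (gradient f x) s = -(r ^ 2 / (1 - r))) :
    r ^ 2 / (1 + r) ≤ inner ℝ (gradient f (x + s) - gradient f x) s ∧
      inner ℝ (gradient f (x + s) - gradient f x) s ≤ r ^ 2 / (1 - r) ∧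
      f (x + s) ≤ f x - r ^ 2 / (1 - r) / 2 := by
  have := selfConcordant_step_one_variable (hasDerivAt_comp_line hf.contDiff x s)
    (hasDerivAt_inner_gradient_line hf.contDiff x s)
    (hasDerivAt_iteratedFDeriv_two_line hf.contDiff x s)
    (fun τ => hf.iteratedFDeriv_two_nonneg _ _)
    (fun τ => by
      have h1 := hf.third_le (x + τ • s) s
      rwa [Real.rpow_div_two_eq_sqrt _ (hf.iteratedFDeriv_two_nonneg _ _),
        ← Nat.cast_ofNat (R := ℝ) (n := 3), Real.rpow_natCast] at h1)
    (by simpa [localNorm] using hr) hr0 hr1 (by simpa using hs)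
  simpa [inner_sub_left] using this

lemma localNorm_smul {x h : EuclideanSpace ℝ (Fin n)} {t : ℝ} (ht : 0 ≤ t) :
    localNorm f x (t • h) = t * localNorm f x h := by
  rw [localNorm, localNorm, iteratedFDeriv_two_apply, iteratedFDeriv_two_apply]
  simp only [Matrix.cons_val_zero, Matrix.cons_val_one, map_smul,
    _root_.smul_apply, smul_eq_mul]
  rw [← mul_assoc, Real.sqrt_mul (by positivity), Real.sqrt_mul_self ht]

end Gradient

/-! ### Strong convexity on a level set -/

section StrongConvexity

variable {n : ℕ} {f : EuclideanSpace ℝ (Fin n) → ℝ} {m : ℝ} {s : Set (EuclideanSpace ℝ (Fin n))}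

lemma StrongConvexOn.add_inner_add_le (hsc : StrongConvexOn s m f) (hf : ContDiff ℝ 3 f)
    {x z : EuclideanSpace ℝ (Fin n)} (hx : x ∈ s) (hz : z ∈ s) :
    f x + inner ℝ (gradient f x) (z - x) + m / 2 * ‖z - x‖ ^ 2 ≤ f z := by
  have h1 := (hasDerivAt_comp_line hf x (z - x) 0).tendsto_slope_zero_right
  have h2 : Tendsto (fun τ : ℝ => f z - f x - (1 - τ) * (m / 2 * ‖z - x‖ ^ 2)) (𝓝[>] 0)
      (𝓝 (f z - f x - (1 - 0) * (m / 2 * ‖z - x‖ ^ 2))) := by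
    refine Tendsto.mono_left (Continuous.tendsto ?_ _) nhdsWithin_le_nhds
    fun_prop
  have h3 := le_of_tendsto_of_tendsto h1 h2 ?_
  · simp only [zero_smul, add_zero] at h3
    linarith
  · filter_upwards [Ioo_mem_nhdsGT (show (0 : ℝ) < 1 by norm_num)] with τ hτ
    have h4 := hsc.2 hx hz (show 0 ≤ 1 - τ by linarith [hτ.2]) hτ.1.le (by ring)
    have h5 : (1 - τ) • x + τ • z = x + τ • (z - x) := by module
    rw [h5, norm_sub_rev x z] at h4
    simp only [smul_eq_mul] at h4
    simp only [zero_add, zero_smul, add_zero, smul_eq_mul]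
    rw [inv_mul_le_iff₀ hτ.1]
    linarith

lemma StrongConvexOn.mul_sq_le_inner (hsc : StrongConvexOn s m f) (hf : ContDiff ℝ 3 f)
    {x z : EuclideanSpace ℝ (Fin n)} (hx : x ∈ s) (hz : z ∈ s) :
    m * ‖z - x‖ ^ 2 ≤ inner ℝ (gradient f z - gradient f x) (z - x) := by
  have h1 := hsc.add_inner_add_le hf hx hz
  have h2 := hsc.add_inner_add_le hf hz hx
  rw [← neg_sub z x, inner_neg_right, norm_neg] at h2
  rw [inner_sub_left]
  linarith

lemma StrongConvexOn.mul_norm_le (hsc : StrongConvexOn s m f) (hf : ContDiff ℝ 3 f)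
    {x z : EuclideanSpace ℝ (Fin n)} (hx : x ∈ s) (hz : z ∈ s) :
    m * ‖z - x‖ ≤ ‖gradient f z - gradient f x‖ := by
  rcases eq_or_ne z x with rfl | hne
  · simp
  have h1 := hsc.mul_sq_le_inner hf hx hz
  have h2 := real_inner_le_norm (gradient f z - gradient f x) (z - x)
  have h3 : 0 < ‖z - x‖ := norm_pos_iff.2 (sub_ne_zero.2 hne)
  nlinarith

/-- The Hessian bound holds at points on the boundary of `s` too, in the directions that point
into `s`. -/
lemma StrongConvexOn.mul_sq_le_iteratedFDeriv (hsc : StrongConvexOn s m f) (hf : ContDiff ℝ 3 f)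
    {x h : EuclideanSpace ℝ (Fin n)} (hx : x ∈ s) (hh : ∀ᶠ τ : ℝ in 𝓝[>] 0, x + τ • h ∈ s) :
    m * ‖h‖ ^ 2 ≤ iteratedFDeriv ℝ 2 f x ![h, h] := by
  have h1 := (hasDerivAt_inner_gradient_line hf x h 0).tendsto_slope_zero_right
  simp only [zero_smul, add_zero, zero_add] at h1
  refine ge_of_tendsto h1 ?_
  filter_upwards [hh, self_mem_nhdsWithin] with τ hτ hpos
  have hpos : 0 < τ := hpos
  have h2 := hsc.mul_sq_le_inner hf hx hτ
  rw [add_sub_cancel_left, inner_smul_right, norm_smul, inner_sub_left, mul_pow, Real.norm_eq_abs,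
    sq_abs] at h2
  rw [smul_eq_mul, le_inv_mul_iff₀ hpos]
  have h3 : τ * (τ * (m * ‖h‖ ^ 2)) ≤
      τ * (inner ℝ (gradient f (x + τ • h)) h - inner ℝ (gradient f x) h) := by linarith
  exact le_of_mul_le_mul_left h3 hpos

lemma StrongConvexOn.sub_le_sq_norm_gradient (hsc : StrongConvexOn s m f) (hf : ContDiff ℝ 3 f)
    (hm : 0 < m) {x a : EuclideanSpace ℝ (Fin n)} (hx : x ∈ s) (ha : a ∈ s) :
    f x - f a ≤ ‖gradient f x‖ ^ 2 / (2 * m) := by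
  have h1 := hsc.add_inner_add_le hf hx ha
  have h2 := (abs_le.1 (abs_real_inner_le_norm (gradient f x) (a - x))).1
  rw [le_div_iff₀ (by positivity)]
  nlinarith [sq_nonneg (‖gradient f x‖ - m * ‖a - x‖)]

end StrongConvexity

section LevelSet

variable {n : ℕ} {f : EuclideanSpace ℝ (Fin n) → ℝ} {m : ℝ} {x₀ : EuclideanSpace ℝ (Fin n)}

lemma isCompact_levelSet (hf : ContDiff ℝ 3 f) (hm : 0 < m)
    (hsc : StrongConvexOn {z | f z ≤ f x₀} m f) : IsCompact {z | f z ≤ f x₀} := by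
  refine Metric.isCompact_of_isClosed_isBounded (isClosed_le hf.continuous continuous_const) ?_
  refine (Metric.isBounded_closedBall (x := x₀) (r := 2 * ‖gradient f x₀‖ / m)).subset ?_
  intro z hz
  have h1 := hsc.add_inner_add_le hf (show x₀ ∈ {z | f z ≤ f x₀} from le_refl (f x₀)) hz
  have h2 := (abs_le.1 (abs_real_inner_le_norm (gradient f x₀) (z - x₀))).1
  have h3 : f z ≤ f x₀ := hz
  rw [Metric.mem_closedBall, dist_eq_norm, le_div_iff₀ hm]
  rcases (norm_nonneg (z - x₀)).eq_or_lt with h | h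
  · rw [← h]; simp
  · have h4 : ‖z - x₀‖ * (‖z - x₀‖ * m) ≤ ‖z - x₀‖ * (2 * ‖gradient f x₀‖) := by nlinarith
    exact le_of_mul_le_mul_left h4 h

lemma exists_minimizer (hf : ContDiff ℝ 3 f) (hm : 0 < m)
    (hsc : StrongConvexOn {z | f z ≤ f x₀} m f) :
    ∃ a, f a ≤ f x₀ ∧ gradient f a = 0 ∧ ∀ z, z ≠ a → f a < f z := by
  obtain ⟨a, ha, hmin⟩ := (isCompact_levelSet hf hm hsc).exists_isMinOn ⟨x₀, le_refl (f x₀)⟩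
    hf.continuous.continuousOn
  have hle : ∀ z, f a ≤ f z := by
    intro z
    by_cases hz : f z ≤ f x₀
    · exact hmin hz
    · exact le_trans ha (not_le.1 hz).le
  have hg : gradient f a = 0 := by
    rw [gradient, IsLocalMin.fderiv_eq_zero (Eventually.of_forall hle), map_zero]
  refine ⟨a, ha, hg, fun z hz => ?_⟩
  by_cases hz' : f z ≤ f x₀
  · have h1 := hsc.add_inner_add_le hf ha hz'
    rw [hg, inner_zero_left] at h1
    have h2 : 0 < ‖z - a‖ := norm_pos_iff.2 (sub_ne_zero.2 hz)
    have : 0 < m / 2 * ‖z - a‖ ^ 2 := by positivity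
    linarith
  · exact lt_of_le_of_lt ha (not_le.1 hz')

lemma exists_bounds_levelSet (hf : ContDiff ℝ 3 f) (hm : 0 < m)
    (hsc : StrongConvexOn {z | f z ≤ f x₀} m f) :
    ∃ M > 0, (∀ x, f x ≤ f x₀ → ‖gradient f x‖ ≤ M) ∧
      (∀ x h, f x ≤ f x₀ → iteratedFDeriv ℝ 2 f x ![h, h] ≤ M * ‖h‖ ^ 2) ∧
      ∀ x z, f x ≤ f x₀ → f z ≤ f x₀ → ‖gradient f z - gradient f x‖ ≤ M * ‖z - x‖ := by
  have hK := isCompact_levelSet hf hm hsc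
  have hg := contDiff_gradient hf
  obtain ⟨M₁, h1⟩ := hK.exists_bound_of_continuousOn hg.continuous.continuousOn
  obtain ⟨M₂, h2⟩ := hK.exists_bound_of_continuousOn
    (hg.continuous_fderiv (by norm_num)).continuousOn
  have hM : 0 < max (max M₁ M₂) 1 := lt_of_lt_of_le one_pos (le_max_right _ _)
  have hM1 : M₁ ≤ max (max M₁ M₂) 1 := (le_max_left _ _).trans (le_max_left _ _)
  have hM2 : M₂ ≤ max (max M₁ M₂) 1 := (le_max_right _ _).trans (le_max_left _ _)
  refine ⟨max (max M₁ M₂) 1, hM, fun x hx => (h1 x hx).trans hM1, fun x h hx => ?_,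
    fun x z hx hz => ?_⟩
  · rw [← inner_fderiv_gradient_self hf]
    calc _ ≤ ‖fderiv ℝ (gradient f) x h‖ * ‖h‖ := real_inner_le_norm _ _
      _ ≤ ‖fderiv ℝ (gradient f) x‖ * ‖h‖ * ‖h‖ := by
        gcongr; exact ContinuousLinearMap.le_opNorm _ _
      _ ≤ max (max M₁ M₂) 1 * ‖h‖ * ‖h‖ := by
        gcongr; exact (h2 x hx).trans hM2
      _ = _ := by ring
  · exact hsc.1.norm_image_sub_le_of_norm_fderiv_le
      (fun y _ => hg.differentiable (by norm_num) y) (fun y hy => (h2 y hy).trans hM2) hx hz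

/-- The Hessian is Lipschitz near `a`, so a gradient difference near `a` differs from its
linearization at `a` by a relative error of the order of the distance to `a`. -/
lemma exists_gradient_sub_linearization_le (hf : ContDiff ℝ 3 f) (a : EuclideanSpace ℝ (Fin n)) :
    ∃ L ≥ 0, ∃ r > 0, ∀ x z, ‖x - a‖ < r → ‖z - a‖ < r →
      ‖gradient f z - gradient f x - fderiv ℝ (gradient f) a (z - x)‖ ≤
        L * (‖x - a‖ + ‖z - a‖) * ‖z - x‖ := by
  have hg := contDiff_gradient hf
  obtain ⟨K, U, hU, hK⟩ :=
    (hg.fderiv_right (m := 1) (by norm_num)).contDiffAt.exists_lipschitzOnWith (x := a)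
  obtain ⟨r, hr, hball⟩ := Metric.mem_nhds_iff.1 hU
  refine ⟨K, K.2, r, hr, fun x z hx hz => ?_⟩
  refine (convex_segment x z).norm_image_sub_le_of_norm_fderiv_le'
    (fun y _ => hg.differentiable (by norm_num) y) (fun y hy => ?_)
    (left_mem_segment ℝ x z) (right_mem_segment ℝ x z)
  have hb : ∀ ρ, ‖x - a‖ ≤ ρ → ‖z - a‖ ≤ ρ → ‖y - a‖ ≤ ρ := fun ρ h1 h2 => by
    have := (convex_closedBall a ρ).segment_subset (mem_closedBall_iff_norm.2 h1)
      (mem_closedBall_iff_norm.2 h2) hy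
    exact mem_closedBall_iff_norm.1 this
  have h1 : ‖y - a‖ ≤ ‖x - a‖ + ‖z - a‖ :=
    hb _ (by linarith [norm_nonneg (z - a)]) (by linarith [norm_nonneg (x - a)])
  have h2 : ‖y - a‖ < r := (hb _ (le_max_left _ _) (le_max_right _ _)).trans_lt (max_lt hx hz)
  have h3 := hK.norm_sub_le (hball (mem_ball_iff_norm.2 h2)) (mem_of_mem_nhds hU)
  exact h3.trans (by gcongr)

/-- The Hessian bound in the interior of the level set. -/
lemma mul_sq_le_iteratedFDeriv_of_lt (hf : ContDiff ℝ 3 f)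
    (hsc : StrongConvexOn {z | f z ≤ f x₀} m f) {a : EuclideanSpace ℝ (Fin n)} (ha : f a < f x₀)
    (h : EuclideanSpace ℝ (Fin n)) : m * ‖h‖ ^ 2 ≤ iteratedFDeriv ℝ 2 f a ![h, h] := by
  refine hsc.mul_sq_le_iteratedFDeriv hf ha.le ?_
  have h1 : ContinuousAt (fun τ : ℝ => f (a + τ • h)) 0 :=
    (hasDerivAt_comp_line hf a h 0).continuousAt
  have h2 := h1.eventually_lt continuousAt_const (by simpa using ha)
  filter_upwards [nhdsWithin_le_nhds h2] with τ hτ using hτ.le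

/-- The Hessian bound in descent directions, which point into the level set even from its
boundary. -/
lemma mul_sq_le_iteratedFDeriv_of_inner_neg (hf : ContDiff ℝ 3 f)
    (hsc : StrongConvexOn {z | f z ≤ f x₀} m f) {x h : EuclideanSpace ℝ (Fin n)} (hx : f x ≤ f x₀)
    (hh : inner ℝ (gradient f x) h < 0) : m * ‖h‖ ^ 2 ≤ iteratedFDeriv ℝ 2 f x ![h, h] := by
  refine hsc.mul_sq_le_iteratedFDeriv hf hx ?_
  have h1 := (hasDerivAt_comp_line hf x h 0).tendsto_slope_zero_right
  simp only [zero_smul, add_zero, zero_add] at h1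
  filter_upwards [h1.eventually_lt_const hh, self_mem_nhdsWithin] with τ hτ hpos
  have hpos : 0 < τ := hpos
  rw [smul_eq_mul, inv_mul_lt_iff₀ hpos, mul_zero] at hτ
  have : f (x + τ • h) ≤ f x₀ := by linarith
  exact this

end LevelSet

/-! ### Broyden methods in normalized coordinates -/

section QuasiNewton

variable {n : ℕ}

/-- Sequences produced by a Broyden method, in coordinates that will be chosen so that the Hessian
at the minimizer is the identity: parameters `φ k`, Hessian approximations `B k`, gradients `g k`,
steps `s k`, step sizes `t k`, and values `F k` of the function above its minimum. Only the
estimates that the convergence proof uses are recorded: `-(g k ⬝ᵥ s k)` is the absolute slope of the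
step, and `g (k + 1) - g k` plays the role of `y k`. -/
structure NormalizedBroyden (ε κ K M A : ℝ) (φ : ℕ → ℝ) (B : ℕ → Matrix (Fin n) (Fin n) ℝ)
    (g s : ℕ → Fin n → ℝ) (t F : ℕ → ℝ) : Prop where
  param : ∀ k, 0 ≤ φ k ∧ φ k ≤ 1 - ε
  posDef : ∀ k, (B k).PosDef
  update : ∀ k, B (k + 1) = broydenHessianUpdate (φ k) (B k) (s k) (g (k + 1) - g k)
  t_pos : ∀ k, 0 < t k
  s_ne : ∀ k, s k ≠ 0
  secant : ∀ k, B k *ᵥ s k = -(t k • g k)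
  curvature_le : ∀ k, (g (k + 1) - g k) ⬝ᵥ s k ≤ -(g k ⬝ᵥ s k)
  le_curvature : ∀ k, (1 - 2 * Real.sqrt (-(g k ⬝ᵥ s k))) * -(g k ⬝ᵥ s k) ≤
    (g (k + 1) - g k) ⬝ᵥ s k
  strong : ∀ k, κ * (s k ⬝ᵥ s k) ≤ (g (k + 1) - g k) ⬝ᵥ s k
  slope_le : ∀ k, -(g k ⬝ᵥ s k) ≤ K * (s k ⬝ᵥ s k)
  lipschitz : ∀ k, (g (k + 1) - g k) ⬝ᵥ (g (k + 1) - g k) ≤ M ^ 2 * (s k ⬝ᵥ s k)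
  nonneg : ∀ k, 0 ≤ F k
  le_gradient : ∀ k, F k ≤ A * (g k ⬝ᵥ g k)
  decrease : ∀ k, F (k + 1) ≤ F k - -(g k ⬝ᵥ s k) / 2

namespace NormalizedBroyden

variable {ε κ K M A : ℝ} {φ : ℕ → ℝ} {B : ℕ → Matrix (Fin n) (Fin n) ℝ} {g s : ℕ → Fin n → ℝ}
  {t F : ℕ → ℝ}

lemma slope_pos (h : NormalizedBroyden ε κ K M A φ B g s t F) (hκ : 0 < κ) (k : ℕ) :
    0 < -(g k ⬝ᵥ s k) :=
  lt_of_lt_of_le (mul_pos hκ (dotProduct_self_pos (h.s_ne k)))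
    ((h.strong k).trans (h.curvature_le k))

lemma dotProduct_mulVec (h : NormalizedBroyden ε κ K M A φ B g s t F) (k : ℕ) :
    s k ⬝ᵥ (B k *ᵥ s k) = t k * -(g k ⬝ᵥ s k) := by
  rw [h.secant, dotProduct_neg, dotProduct_smul, dotProduct_comm (s k), smul_eq_mul, mul_neg]

/-- Since `B s` is a negative multiple of `g`, the angle between `s` and `B s` is that between `s`
and `-g`. -/
lemma sq_slope_eq (h : NormalizedBroyden ε κ K M A φ B g s t F) (hκ : 0 < κ) (k : ℕ) :
    (-(g k ⬝ᵥ s k)) ^ 2 = cosSq (B k) (s k) * (g k ⬝ᵥ g k) * (s k ⬝ᵥ s k) := by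
  have h1 := h.dotProduct_mulVec k
  have h2 : (B k *ᵥ s k) ⬝ᵥ (B k *ᵥ s k) = t k ^ 2 * (g k ⬝ᵥ g k) := by
    rw [h.secant, neg_dotProduct_neg, smul_dotProduct, dotProduct_smul, smul_eq_mul, smul_eq_mul]
    ring
  have hσ := h.slope_pos hκ k
  have ht := h.t_pos k
  have hs := dotProduct_self_pos (h.s_ne k)
  have hg : 0 < g k ⬝ᵥ g k := dotProduct_self_pos fun h0 => by simp [h0] at hσ
  rw [cosSq, rayleighQuotient, imageQuotient, h1, h2]
  field_simp

lemma geometric_decrease (h : NormalizedBroyden ε κ K M A φ B g s t F) (hκ : 0 < κ) (hK : 0 < K)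
    (hA : 0 < A) (k : ℕ) : F (k + 1) ≤ F k - 1 / (2 * A * K) * cosSq (B k) (s k) * F k := by
  have hσ := h.slope_pos hκ k
  have hs := dotProduct_self_pos (h.s_ne k)
  have hc := cosSq_pos (h.posDef k) (h.s_ne k)
  have h1 := h.sq_slope_eq hκ k
  have h2 := h.slope_le k
  have h3 := h.decrease k
  set σ := -(g k ⬝ᵥ s k)
  have h4 : cosSq (B k) (s k) * (g k ⬝ᵥ g k) ≤ K * σ := by
    have : cosSq (B k) (s k) * (g k ⬝ᵥ g k) * (s k ⬝ᵥ s k) ≤ K * σ * (s k ⬝ᵥ s k) := by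
      rw [← h1]; nlinarith
    exact le_of_mul_le_mul_right this hs
  have h5 : cosSq (B k) (s k) * F k ≤ A * (K * σ) := by
    calc _ ≤ cosSq (B k) (s k) * (A * (g k ⬝ᵥ g k)) := by
          gcongr; exact h.le_gradient k
      _ = A * (cosSq (B k) (s k) * (g k ⬝ᵥ g k)) := by ring
      _ ≤ _ := by gcongr
  have h6 : 1 / (2 * A * K) * cosSq (B k) (s k) * F k ≤ σ / 2 := by
    rw [mul_assoc, one_div, inv_mul_le_iff₀ (by positivity)]
    linarith
  linarith

lemma tendsto_zero (h : NormalizedBroyden ε κ K M A φ B g s t F) (hε : 0 < ε) (hκ : 0 < κ)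
    (hK : 0 < K) (hM : 0 < M) (hA : 0 < A) : Tendsto F atTop (𝓝 0) := by
  obtain ⟨C, γ, hγ, hC⟩ := exists_updatePotential_le_add_log_cosSq (n := n) hκ hM hε
  refine tendsto_zero_of_decrease_of_potential (c := fun k => cosSq (B k) (s k))
    (ψ := fun k => updatePotential (B k)) (C := C) (by positivity : 0 < 1 / (2 * A * K)) hγ
    h.nonneg (fun k => cosSq_pos (h.posDef k) (h.s_ne k)) (h.geometric_decrease hκ hK hA)
    (fun k => zero_le_trace_sub_log_det (h.posDef k)) fun k hk => ?_
  rw [h.update k]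
  exact hC _ _ _ _ (h.posDef k) (h.param k).1 (h.param k).2 (h.s_ne k) (h.strong k)
    (h.lipschitz k) hk

/-- If the gradient differences are close to the steps, with relative errors controlled by `√F`,
then both quotients of `B k` at `s k` tend to `1`; that is, `‖B k s k - s k‖ = o(‖s k‖)`. -/
lemma tendsto_quotients (h : NormalizedBroyden ε κ K M A φ B g s t F) (hε : 0 < ε) (hκ : 0 < κ)
    (hK : 0 < K) (hM : 0 < M) (hA : 0 < A) {L : ℝ} (hL : 0 ≤ L)
    (hnear : ∀ᶠ k in atTop, (g (k + 1) - g k - s k) ⬝ᵥ (g (k + 1) - g k - s k) ≤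
      (L * Real.sqrt (F k)) ^ 2 * (s k ⬝ᵥ s k)) :
    Tendsto (fun k => imageQuotient (B k) (s k)) atTop (𝓝 1) ∧
      Tendsto (fun k => rayleighQuotient (B k) (s k)) atTop (𝓝 1) := by
  have hF := h.tendsto_zero hε hκ hK hM hA
  have he : Tendsto (fun k => L * Real.sqrt (F k)) atTop (𝓝 0) := by
    have := ((Real.continuous_sqrt.tendsto 0).comp hF).const_mul L
    simpa using this
  obtain ⟨N, hN⟩ := eventually_atTop.1
    (hnear.and (he.eventually_le_const (show 0 < ε / 24 by positivity)))
  have hc := fun k => cosSq_pos (h.posDef k) (h.s_ne k)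
  have hp := fun k => imageQuotient_pos (h.posDef k) (h.s_ne k)
  obtain ⟨h1, h2⟩ := tendsto_zero_of_potential_decrease (F := fun k => F (k + N))
    (c := fun k => cosSq (B (k + N)) (s (k + N))) (ψ := fun k => updatePotential (B (k + N)))
    (e := fun k => L * Real.sqrt (F (k + N)))
    (h := fun k => imageQuotient (B (k + N)) (s (k + N)) - 1
      - Real.log (imageQuotient (B (k + N)) (s (k + N))))
    (κ := 1 / (2 * A * K)) (ε := ε / 2) (A := L) (E := ε / 24)
    (by positivity) (by positivity) hL (fun k => h.nonneg _) (fun k => hc _)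
    (fun k => cosSq_le_one (h.posDef _) (h.s_ne _))
    (fun k => by
      have := h.geometric_decrease hκ hK hA (k + N)
      rwa [show k + N + 1 = k + 1 + N by ring] at this)
    (fun k => zero_le_trace_sub_log_det (h.posDef _))
    (fun k => by
      have := Real.log_le_sub_one_of_pos (hp (k + N))
      linarith)
    (fun k => by positivity) (fun k => (hN (k + N) (by omega)).2) (fun k => le_rfl)
    (fun k => by
      have h3 := hN (k + N) (by omega)
      have := updatePotential_le_of_near hε (h.posDef (k + N)) (h.param (k + N)).1
        (h.param (k + N)).2 (h.s_ne (k + N)) (e := L * Real.sqrt (F (k + N))) (by positivity)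
        (by linarith [h3.2]) h3.1
      rwa [← h.update, show k + N + 1 = k + 1 + N by ring] at this)
  have h3 := (tendsto_add_atTop_iff_nat
    (f := fun k => imageQuotient (B k) (s k)) N).1 (tendsto_one_of_sub_log (fun k => hp _) h1)
  have h4 : Tendsto (fun k => cosSq (B k) (s k)) atTop (𝓝 1) := by
    refine (tendsto_add_atTop_iff_nat N).1 ?_
    have := (Real.continuous_exp.tendsto 0).comp h2
    simpa [Function.comp_def, Real.exp_log (hc _)] using this
  refine ⟨h3, ?_⟩
  have := h4.mul h3
  refine (Tendsto.congr (fun k => ?_) this).trans (by simp)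
  rw [cosSq, div_mul_cancel₀ _ (hp k).ne']

/-- The Dennis–Moré argument: the step sizes `t k` tend to `1`, and the gradient at the new point is
small compared with the step because `t g₊ = (s - B s) + (y - s) + (t - 1) y`. -/
lemma tendsto_gradient_div_step (h : NormalizedBroyden ε κ K M A φ B g s t F) (hε : 0 < ε)
    (hκ : 0 < κ) (hK : 0 < K) (hM : 0 < M) (hA : 0 < A) {L : ℝ} (hL : 0 ≤ L)
    (hnear : ∀ᶠ k in atTop, (g (k + 1) - g k - s k) ⬝ᵥ (g (k + 1) - g k - s k) ≤
      (L * Real.sqrt (F k)) ^ 2 * (s k ⬝ᵥ s k)) :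
    Tendsto (fun k => (g (k + 1) ⬝ᵥ g (k + 1)) / (s k ⬝ᵥ s k)) atTop (𝓝 0) := by
  have hF := h.tendsto_zero hε hκ hK hM hA
  obtain ⟨hp, hq⟩ := h.tendsto_quotients hε hκ hK hM hA hL hnear
  have he : Tendsto (fun k => L * Real.sqrt (F k)) atTop (𝓝 0) := by
    have := ((Real.continuous_sqrt.tendsto 0).comp hF).const_mul L
    simpa using this
  have hs := fun k => dotProduct_self_pos (h.s_ne k)
  have hσ := h.slope_pos hκ
  have hσ0 : Tendsto (fun k => -(g k ⬝ᵥ s k)) atTop (𝓝 0) := by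
    have h1 : Tendsto (fun k => 2 * (F k - F (k + 1))) atTop (𝓝 0) := by
      simpa using (hF.sub (hF.comp (tendsto_add_atTop_nat 1))).const_mul 2
    exact squeeze_zero (fun k => (hσ k).le) (fun k => by linarith [h.decrease k]) h1
  have h1 : Tendsto (fun k => ((g (k + 1) - g k) ⬝ᵥ s k) / -(g k ⬝ᵥ s k)) atTop (𝓝 1) := by
    have h2 : Tendsto (fun k => 1 - 2 * Real.sqrt (-(g k ⬝ᵥ s k))) atTop (𝓝 1) := by
      have := (((Real.continuous_sqrt.tendsto 0).comp hσ0).const_mul 2).const_sub 1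
      simpa using this
    refine tendsto_of_tendsto_of_tendsto_of_le_of_le h2 tendsto_const_nhds (fun k => ?_)
      fun k => ?_
    · exact (le_div_iff₀ (hσ k)).2 (h.le_curvature k)
    · exact (div_le_one (hσ k)).2 (h.curvature_le k)
  have h2 : Tendsto (fun k => ((g (k + 1) - g k) ⬝ᵥ s k) / (s k ⬝ᵥ s k)) atTop (𝓝 1) := by
    refine tendsto_iff_norm_sub_tendsto_zero.2 (squeeze_zero' (Eventually.of_forall fun k =>
      norm_nonneg _) ?_ he)
    filter_upwards [hnear] with k hk
    rw [div_sub_one (hs k).ne', ← sub_dotProduct, Real.norm_eq_abs, abs_div, abs_of_pos (hs k),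
      div_le_iff₀ (hs k)]
    have hL' : 0 ≤ L * Real.sqrt (F k) := by positivity
    refine abs_le_of_sq_le_sq ?_ (mul_nonneg hL' (hs k).le)
    calc _ ≤ _ := sq_dotProduct_le _ _
      _ ≤ (L * Real.sqrt (F k)) ^ 2 * (s k ⬝ᵥ s k) * (s k ⬝ᵥ s k) :=
        mul_le_mul_of_nonneg_right hk (hs k).le
      _ = _ := by ring
  have ht : Tendsto t atTop (𝓝 1) := by
    have h3 := (hq.div h2 one_ne_zero).mul h1
    refine (Tendsto.congr (fun k => ?_) h3).trans (by simp)
    have hy : 0 < (g (k + 1) - g k) ⬝ᵥ s k :=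
      lt_of_lt_of_le (mul_pos hκ (hs k)) (h.strong k)
    have := hσ k
    have := hs k
    simp only [Pi.div_apply]
    rw [rayleighQuotient, h.dotProduct_mulVec]
    generalize (g (k + 1) - g k) ⬝ᵥ s k = a at *
    generalize -(g k ⬝ᵥ s k) = b at *
    field_simp
  -- The bound for `‖g₊‖² / ‖s‖²`; its first term is `‖s - B s‖² / ‖s‖² = 1 - 2 q + p q`.
  have hR : Tendsto (fun k => 3 * ((1 - 2 * rayleighQuotient (B k) (s k)
      + imageQuotient (B k) (s k) * rayleighQuotient (B k) (s k)) + (L * Real.sqrt (F k)) ^ 2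
      + (t k - 1) ^ 2 * M ^ 2) / t k ^ 2) atTop (𝓝 0) := by
    have := (((((hq.const_mul 2).const_sub 1).add (hp.mul hq)).add (he.pow 2)).add
      (((ht.sub_const 1).pow 2).mul_const (M ^ 2))).const_mul 3 |>.div (ht.pow 2) (by norm_num)
    convert! this using 2
    norm_num
  refine squeeze_zero' (Eventually.of_forall fun k => div_nonneg ?_ (hs k).le) ?_ hR
  · simpa using dotProduct_star_self_nonneg (g (k + 1))
  filter_upwards [hnear] with k hk
  have htk := h.t_pos k
  rw [div_le_div_iff₀ (hs k) (by positivity)]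
  have hw : (s k - B k *ᵥ s k) ⬝ᵥ (s k - B k *ᵥ s k) = (1 - 2 * rayleighQuotient (B k) (s k)
      + imageQuotient (B k) (s k) * rayleighQuotient (B k) (s k)) * (s k ⬝ᵥ s k) := by
    have h3 := dotProduct_mulVec_self_pos (h.posDef k) (h.s_ne k)
    have := hs k
    simp only [dotProduct_sub, sub_dotProduct, dotProduct_comm (B k *ᵥ s k) (s k)]
    rw [rayleighQuotient, imageQuotient]
    field_simp
    ring
  have hdec : t k • g (k + 1) = (s k - B k *ᵥ s k) + (g (k + 1) - g k - s k)
      + (t k - 1) • (g (k + 1) - g k) := by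
    rw [h.secant]; module
  have h3 : (g (k + 1) ⬝ᵥ g (k + 1)) * t k ^ 2 = (t k • g (k + 1)) ⬝ᵥ (t k • g (k + 1)) := by
    rw [smul_dotProduct, dotProduct_smul, smul_eq_mul, smul_eq_mul]; ring
  have h4 : ∀ u v w : Fin n → ℝ, (u + v + w) ⬝ᵥ (u + v + w) ≤
      3 * (u ⬝ᵥ u + v ⬝ᵥ v + w ⬝ᵥ w) := by
    intro u v w
    simp only [dotProduct, ← Finset.sum_add_distrib, Finset.mul_sum]
    refine Finset.sum_le_sum fun i _ => ?_
    simp only [Pi.add_apply]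
    nlinarith [sq_nonneg (u i - v i), sq_nonneg (u i - w i), sq_nonneg (v i - w i)]
  rw [h3, hdec]
  refine (h4 _ _ _).trans ?_
  rw [hw, smul_dotProduct, dotProduct_smul, smul_eq_mul, smul_eq_mul]
  have h5 := mul_le_mul_of_nonneg_left (h.lipschitz k) (sq_nonneg (t k - 1))
  nlinarith

end NormalizedBroyden

end QuasiNewton

/-! ### The adaptive step -/

section AdaptiveStep

variable {n : ℕ} {f : EuclideanSpace ℝ (Fin n) → ℝ} {m : ℝ} {x₀ : EuclideanSpace ℝ (Fin n)}

lemma EuclideanSpace.real_inner_eq_dotProduct (u v : EuclideanSpace ℝ (Fin n)) :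
    inner ℝ u v = WithLp.ofLp u ⬝ᵥ WithLp.ofLp v := by
  rw [EuclideanSpace.inner_eq_star_dotProduct, star_trivial, dotProduct_comm]

lemma EuclideanSpace.norm_sq_eq_dotProduct (u : EuclideanSpace ℝ (Fin n)) :
    ‖u‖ ^ 2 = WithLp.ofLp u ⬝ᵥ WithLp.ofLp u := by
  rw [← real_inner_self_eq_norm_sq, EuclideanSpace.real_inner_eq_dotProduct]

lemma adaptiveStep_eq_self {x : EuclideanSpace ℝ (Fin n)} (hx : gradient f x = 0)
    (H : Matrix (Fin n) (Fin n) ℝ) : adaptiveStep f H x = x := by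
  simp [adaptiveStep, searchDirection, hx]

lemma inner_gradient_searchDirection_neg {H : Matrix (Fin n) (Fin n) ℝ} (hH : H.PosDef)
    {x : EuclideanSpace ℝ (Fin n)} (hx : gradient f x ≠ 0) :
    inner ℝ (gradient f x) (searchDirection f H x) < 0 := by
  rw [searchDirection, inner_neg_right, EuclideanSpace.real_inner_eq_dotProduct,
    Matrix.toLpLin_apply, neg_lt_zero]
  exact dotProduct_mulVec_self_pos hH (by simpa using hx)

/-- The step size makes the local norm of the step `r = ρ / (ρ + δ) < 1` and its slope
`-r² / (1 - r)`. -/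
lemma exists_adaptiveStep_eq (hf : ContDiff ℝ 3 f) (hm : 0 < m)
    (hsc : StrongConvexOn {z | f z ≤ f x₀} m f) {H : Matrix (Fin n) (Fin n) ℝ} (hH : H.PosDef)
    {x : EuclideanSpace ℝ (Fin n)} (hx : f x ≤ f x₀) (hg : gradient f x ≠ 0) :
    ∃ t r : ℝ, 0 < t ∧ 0 < r ∧ r < 1 ∧
      adaptiveStep f H x = x + t • searchDirection f H x ∧
      localNorm f x (t • searchDirection f H x) = r ∧
      inner ℝ (gradient f x) (t • searchDirection f H x) = -(r ^ 2 / (1 - r)) := by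
  have hneg := inner_gradient_searchDirection_neg hH hg
  set d := searchDirection f H x with hd
  have hd0 : 0 < ‖d‖ := norm_pos_iff.2 fun h => by simp [h] at hneg
  have hδ : 0 < localNorm f x d := Real.sqrt_pos.2 <| lt_of_lt_of_le
    (by positivity) (mul_sq_le_iteratedFDeriv_of_inner_neg hf hsc hx hneg)
  have hρ : 0 < -inner ℝ (gradient f x) d := by linarith
  have ht : adaptiveStepSize f x d = -inner ℝ (gradient f x) d /
    ((-inner ℝ (gradient f x) d + localNorm f x d) * localNorm f x d) := rfl
  have ht0 : 0 < adaptiveStepSize f x d := by rw [ht]; positivity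
  refine ⟨adaptiveStepSize f x d, -inner ℝ (gradient f x) d /
    (-inner ℝ (gradient f x) d + localNorm f x d), ht0, by positivity,
    (div_lt_one (by positivity)).2 (by linarith), rfl, ?_, ?_⟩
  · rw [localNorm_smul ht0.le, ht]
    field_simp
  · rw [inner_smul_right, ht]
    set ρ := -inner ℝ (gradient f x) d
    set δ := localNorm f x d
    have h1 : inner ℝ (gradient f x) d = -ρ := by simp [ρ]
    have h2 : 1 - ρ / (ρ + δ) = δ / (ρ + δ) := by field_simp; ring
    rw [h1, h2]
    field_simp

/-- What an adaptive step in a positive definite metric achieves, with a constant that is uniform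
on the level set. -/
lemma exists_adaptiveStep_bounds (hf : StandardSelfConcordant f) (hm : 0 < m)
    (hsc : StrongConvexOn {z | f z ≤ f x₀} m f) :
    ∃ K > (0 : ℝ), ∀ (H : Matrix (Fin n) (Fin n) ℝ) (x : EuclideanSpace ℝ (Fin n)), H.PosDef →
      f x ≤ f x₀ → gradient f x ≠ 0 → ∃ t > (0 : ℝ), ∃ s : EuclideanSpace ℝ (Fin n), s ≠ 0 ∧
        adaptiveStep f H x = x + s ∧ s = t • searchDirection f H x ∧
        inner ℝ (gradient f (x + s) - gradient f x) s ≤ -inner ℝ (gradient f x) s ∧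
        (1 - 2 * Real.sqrt (-inner ℝ (gradient f x) s)) * -inner ℝ (gradient f x) s ≤
          inner ℝ (gradient f (x + s) - gradient f x) s ∧
        -inner ℝ (gradient f x) s ≤ K * ‖s‖ ^ 2 ∧
        f (x + s) ≤ f x - -inner ℝ (gradient f x) s / 2 := by
  obtain ⟨M, hM, hMg, hMh, -⟩ := exists_bounds_levelSet hf.contDiff hm hsc
  refine ⟨M + M * Real.sqrt M, by positivity, fun H x hH hx hg => ?_⟩
  obtain ⟨t, r, ht, hr0, hr1, hstep, hr, hslope⟩ :=
    exists_adaptiveStep_eq hf.contDiff hm hsc hH hx hg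
  set s := t • searchDirection f H x with hs
  obtain ⟨h1, h2, h3⟩ := hf.step hr hr0 hr1 hslope
  have hr1' : 0 < 1 - r := by linarith
  have hσ : -inner ℝ (gradient f x) s = r ^ 2 / (1 - r) := by rw [hslope, neg_neg]
  have hσ0 : 0 < r ^ 2 / (1 - r) := by positivity
  have hs0 : s ≠ 0 := fun h => by rw [h, inner_zero_right] at hσ; linarith
  refine ⟨t, ht, s, hs0, hstep, hs, ?_, ?_, ?_, ?_⟩
  · rw [hσ]; exact h2
  · rw [hσ]
    refine le_trans ?_ h1
    have h4 : r ≤ Real.sqrt (r ^ 2 / (1 - r)) := by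
      refine Real.le_sqrt_of_sq_le ?_
      rw [le_div_iff₀ hr1']
      nlinarith
    have h5 : (1 - 2 * Real.sqrt (r ^ 2 / (1 - r))) * (r ^ 2 / (1 - r)) ≤
        (1 - 2 * r) * (r ^ 2 / (1 - r)) := by gcongr
    refine h5.trans ?_
    rw [mul_div_assoc', div_le_div_iff₀ hr1' (by positivity)]
    nlinarith [sq_nonneg r, mul_pos hr0 hr0, mul_pos (mul_pos hr0 hr0) (mul_pos hr0 hr0)]
  · -- `σ = r² / (1 - r)` satisfies `σ = r² + σ r`, where `σ = O(‖s‖)` and `r = O(‖s‖)`.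
    rw [hσ]
    have hupp := hMh x s hx
    have hrsq : r ^ 2 = iteratedFDeriv ℝ 2 f x ![s, s] := by
      rw [← hr, localNorm, Real.sq_sqrt (hf.iteratedFDeriv_two_nonneg _ _)]
    rw [← hrsq] at hupp
    have h4 : r ^ 2 / (1 - r) ≤ M * ‖s‖ := by
      rw [← hσ]
      have := (abs_le.1 (abs_real_inner_le_norm (gradient f x) s)).1
      have := mul_le_mul_of_nonneg_right (hMg x hx) (norm_nonneg s)
      linarith
    have h5 : r ^ 2 / (1 - r) = r ^ 2 + r ^ 2 / (1 - r) * r := by field_simp; ring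
    have h6 : r ^ 2 / (1 - r) * r ≤ M * Real.sqrt M * ‖s‖ ^ 2 := by
      refine le_of_abs_le (abs_le_of_sq_le_sq ?_ (by positivity))
      calc (r ^ 2 / (1 - r) * r) ^ 2 = (r ^ 2 / (1 - r)) ^ 2 * r ^ 2 := by ring
        _ ≤ (M * ‖s‖) ^ 2 * (M * ‖s‖ ^ 2) := by gcongr
        _ = M ^ 2 * M * ‖s‖ ^ 4 := by ring
        _ = (M * Real.sqrt M * ‖s‖ ^ 2) ^ 2 := by
          rw [mul_pow, mul_pow, Real.sq_sqrt hM.le]; ring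
    linarith
  · rw [hσ]; exact h3

end AdaptiveStep

section NormEquivalence

variable {n : ℕ}

lemma exists_mulVec_dotProduct_le (Q : Matrix (Fin n) (Fin n) ℝ) :
    ∃ C > (0 : ℝ), ∀ v : Fin n → ℝ, (Q *ᵥ v) ⬝ᵥ (Q *ᵥ v) ≤ C * (v ⬝ᵥ v) := by
  refine ⟨1 + ∑ i, Q i ⬝ᵥ Q i, ?_, fun v => ?_⟩
  · have : 0 ≤ ∑ i, Q i ⬝ᵥ Q i :=
      Finset.sum_nonneg fun i _ => by simpa using dotProduct_star_self_nonneg (Q i)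
    linarith
  · have h1 : (Q *ᵥ v) ⬝ᵥ (Q *ᵥ v) ≤ ∑ i, (Q i ⬝ᵥ Q i) * (v ⬝ᵥ v) := by
      refine Finset.sum_le_sum fun i _ => ?_
      rw [← pow_two]
      exact sq_dotProduct_le (Q i) v
    rw [← Finset.sum_mul] at h1
    have : 0 ≤ v ⬝ᵥ v := by simpa using dotProduct_star_self_nonneg v
    linarith

end NormEquivalence

/-! ### Convergence -/

section Convergence

variable {n : ℕ} {f : EuclideanSpace ℝ (Fin n) → ℝ} {m : ℝ} {x₀ a : EuclideanSpace ℝ (Fin n)}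

/-- The Hessian at `a` as a positive definite matrix. -/
lemma exists_hessian_matrix (hf : ContDiff ℝ 3 f) (hm : 0 < m)
    (hlow : ∀ h, m * ‖h‖ ^ 2 ≤ iteratedFDeriv ℝ 2 f a ![h, h]) :
    ∃ G : Matrix (Fin n) (Fin n) ℝ, G.PosDef ∧
      ∀ h, WithLp.ofLp (fderiv ℝ (gradient f) a h) = G *ᵥ WithLp.ofLp h := by
  set G := Matrix.toEuclideanLin.symm (fderiv ℝ (gradient f) a).toLinearMap with hG
  have hG1 : Matrix.toEuclideanLin G = (fderiv ℝ (gradient f) a).toLinearMap := by simp [hG]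
  have hG2 : ∀ h, WithLp.ofLp (fderiv ℝ (gradient f) a h) = G *ᵥ WithLp.ofLp h := by
    intro h
    have h1 : fderiv ℝ (gradient f) a h = Matrix.toEuclideanLin G h := by rw [hG1]; rfl
    rw [h1, Matrix.toLpLin_apply]
  refine ⟨G, PosDef.of_dotProduct_mulVec_pos ?_ fun v hv => ?_, hG2⟩
  · rw [← Matrix.isSymmetric_toEuclideanLin_iff, hG1]
    exact fun h k => inner_fderiv_gradient_comm hf a h k
  · have h1 := hlow (WithLp.toLp 2 v)
    rw [← inner_fderiv_gradient_self hf, EuclideanSpace.real_inner_eq_dotProduct, hG2,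
      dotProduct_comm] at h1
    have h2 : 0 < ‖WithLp.toLp 2 v‖ := norm_pos_iff.2 (by simpa using hv)
    rw [star_trivial]
    exact lt_of_lt_of_le (by positivity) h1

lemma adaptiveStep_mem_levelSet (hf : StandardSelfConcordant f) (hm : 0 < m)
    (hsc : StrongConvexOn {z | f z ≤ f x₀} m f) {H : Matrix (Fin n) (Fin n) ℝ} (hH : H.PosDef)
    {x x' : EuclideanSpace ℝ (Fin n)} (hx : f x ≤ f x₀) (hg : gradient f x ≠ 0)
    (hx' : x' = adaptiveStep f H x) :
    f x' ≤ f x₀ ∧ WithLp.ofLp (x' - x) ≠ 0 ∧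
      0 < WithLp.ofLp (gradient f x' - gradient f x) ⬝ᵥ WithLp.ofLp (x' - x) := by
  obtain ⟨K, hK, hstep⟩ := exists_adaptiveStep_bounds hf hm hsc
  obtain ⟨t, ht, s, hs, hxs, hst, -, -, -, hdec⟩ := hstep _ _ hH hx hg
  rw [← hxs, ← hx'] at hdec
  have hsk : x' - x = s := by rw [hx', hxs]; simp
  have hσ : inner ℝ (gradient f x) s < 0 := by
    rw [hst, inner_smul_right]
    exact mul_neg_of_pos_of_neg ht (inner_gradient_searchDirection_neg hH hg)
  have hle : f x' ≤ f x₀ := by linarith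
  refine ⟨hle, by simpa [hsk] using hs, ?_⟩
  rw [← EuclideanSpace.real_inner_eq_dotProduct]
  have h2 : 0 < ‖x' - x‖ := norm_pos_iff.2 (by rwa [hsk])
  exact lt_of_lt_of_le (by positivity) (hsc.mul_sq_le_inner hf.contDiff hx hle)

/-- As long as no gradient vanishes, the iterates stay in the level set and the Hessian
approximations stay positive definite. -/
lemma IsAdaptiveBroyden.mem_and_posDef (hf : StandardSelfConcordant f) (hm : 0 < m)
    (hsc : StrongConvexOn {z | f z ≤ f x₀} m f) {φ : ℕ → ℝ} (hφ : ∀ k, 0 ≤ φ k)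
    {x : ℕ → EuclideanSpace ℝ (Fin n)} {B : ℕ → Matrix (Fin n) (Fin n) ℝ}
    (h : IsAdaptiveBroyden f φ x₀ x B) (hg : ∀ k, gradient f (x k) ≠ 0) (k : ℕ) :
    f (x k) ≤ f x₀ ∧ (B k).PosDef := by
  induction k with
  | zero => exact ⟨by rw [h.start], h.posDef⟩
  | succ k ih =>
    obtain ⟨h1, h2, h3⟩ := adaptiveStep_mem_levelSet hf hm hsc ih.2.inv ih.1 (hg k) (h.step k)
    refine ⟨h1, ?_⟩
    rw [h.update k (hg k)]
    exact posDef_broydenHessianUpdate ih.2 (hφ k) (dotProduct_mulVec_self_pos ih.2 h2) h3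

lemma convergesQSuperlinearly_of_eventually_eq {x : ℕ → EuclideanSpace ℝ (Fin n)} {N : ℕ}
    (h : ∀ k ≥ N, x k = a) : ConvergesQSuperlinearly x a := by
  constructor
  · exact tendsto_const_nhds.congr' (eventually_atTop.2 ⟨N, fun k hk => (h k hk).symm⟩)
  · refine IsLittleO.of_bound fun c hc => eventually_atTop.2 ⟨N, fun k hk => ?_⟩
    rw [h k hk, h (k + 1) (by omega)]
    simp

/-- From a gradient that is small compared with the step to Q-superlinear convergence. -/
lemma convergesQSuperlinearly_of_gradient_isLittleO {x g : ℕ → EuclideanSpace ℝ (Fin n)}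
    (hm : 0 < m) (hlim : Tendsto x atTop (𝓝 a)) (hg : ∀ k, m * ‖x k - a‖ ≤ ‖g k‖)
    (ho : (fun k => g (k + 1)) =o[atTop] fun k => x (k + 1) - x k) :
    ConvergesQSuperlinearly x a := by
  refine ⟨hlim, IsLittleO.of_bound fun c hc => ?_⟩
  -- `‖e₊‖ ≤ θ (‖e₊‖ + ‖e‖)` with `θ = min (1/2) (c/2)` gives `‖e₊‖ ≤ c ‖e‖`.
  filter_upwards [ho.bound (show 0 < m * min (1 / 2) (c / 2) by positivity)] with k hk
  have h1 := hg (k + 1)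
  have h2 : ‖x (k + 1) - x k‖ ≤ ‖x (k + 1) - a‖ + ‖x k - a‖ := by
    rw [show x (k + 1) - x k = (x (k + 1) - a) - (x k - a) by abel]
    exact norm_sub_le _ _
  have h3 : ‖x (k + 1) - a‖ ≤ min (1 / 2) (c / 2) * ‖x (k + 1) - x k‖ := by
    rw [mul_assoc] at hk
    exact le_of_mul_le_mul_left (h1.trans hk) hm
  have h4 : min (1 / 2) (c / 2) * ‖x (k + 1) - x k‖ ≤
      min (1 / 2) (c / 2) * (‖x (k + 1) - a‖ + ‖x k - a‖) := by gcongr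
  have h5 : min (1 / 2) (c / 2) * ‖x (k + 1) - a‖ ≤ 1 / 2 * ‖x (k + 1) - a‖ := by
    gcongr; exact min_le_left _ _
  have h6 : min (1 / 2) (c / 2) * ‖x k - a‖ ≤ c / 2 * ‖x k - a‖ := by
    gcongr; exact min_le_right _ _
  linarith

/-- A Broyden method that does not stop. With `Qᵀ G Q = 1` for the Hessian `G` at the minimizer, the
sequences `Qᵀ B k Q`, `Qᵀ g k` and `Q⁻¹ s k` form a normalized Broyden method. -/
lemma IsAdaptiveBroyden.convergesQSuperlinearly_of_ne (hf : StandardSelfConcordant f) (hm : 0 < m)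
    (hsc : StrongConvexOn {z | f z ≤ f x₀} m f) (ha : f a ≤ f x₀) (hga : gradient f a = 0)
    (hmin : ∀ z, z ≠ a → f a < f z) {φ : ℕ → ℝ} {φmax : ℝ} (hφmax : φmax < 1)
    (hφ : ∀ k, 0 ≤ φ k ∧ φ k ≤ φmax)
    {x : ℕ → EuclideanSpace ℝ (Fin n)} {B : ℕ → Matrix (Fin n) (Fin n) ℝ}
    (h : IsAdaptiveBroyden f φ x₀ x B) (hg : ∀ k, gradient f (x k) ≠ 0) :
    ConvergesQSuperlinearly x a := by
  have hinv := h.mem_and_posDef hf hm hsc (fun k => (hφ k).1) hg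
  have hx : ∀ k, f (x k) ≤ f x₀ := fun k => (hinv k).1
  have hB : ∀ k, (B k).PosDef := fun k => (hinv k).2
  have hx₀ : x₀ ≠ a := fun h0 => hg 0 (by rw [h.start, h0, hga])
  obtain ⟨G, hG, hGm⟩ := exists_hessian_matrix hf.contDiff hm
    (mul_sq_le_iteratedFDeriv_of_lt hf.contDiff hsc (hmin _ hx₀))
  obtain ⟨Q, hQ, hQG⟩ := hG.exists_transpose_mul_mul_eq_one
  have hQd : IsUnit Q.det := (isUnit_iff_isUnit_det _).1 hQ
  have hQQ : ∀ v, Q *ᵥ (Q⁻¹ *ᵥ v) = v := fun v => by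
    rw [mulVec_mulVec, mul_nonsing_inv _ hQd, one_mulVec]
  have hQT : ∀ v, (Qᵀ)⁻¹ *ᵥ (Qᵀ *ᵥ v) = v := fun v => by
    rw [mulVec_mulVec, nonsing_inv_mul _ (by rwa [det_transpose]), one_mulVec]
  have hdot : ∀ u v, (Qᵀ *ᵥ u) ⬝ᵥ (Q⁻¹ *ᵥ v) = u ⬝ᵥ v := fun u v => by
    rw [mulVec_transpose, ← dotProduct_mulVec, hQQ]
  obtain ⟨C₁, hC₁, hQ1⟩ := exists_mulVec_dotProduct_le Q
  obtain ⟨C₂, hC₂, hQ2⟩ := exists_mulVec_dotProduct_le Q⁻¹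
  obtain ⟨C₃, hC₃, hQ3⟩ := exists_mulVec_dotProduct_le Qᵀ
  obtain ⟨C₄, hC₄, hQ4⟩ := exists_mulVec_dotProduct_le (Qᵀ)⁻¹
  obtain ⟨M, hM, -, -, hMlip⟩ := exists_bounds_levelSet hf.contDiff hm hsc
  obtain ⟨K, hK, hstep⟩ := exists_adaptiveStep_bounds hf hm hsc
  obtain ⟨L, hL, r, hr, hlin⟩ := exists_gradient_sub_linearization_le hf.contDiff a
  choose t ht s hs hxs hst hcurv hcurv' hslope hdec using
    fun k => hstep _ _ (hB k).inv (hx k) (hg k)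
  have hxs : ∀ k, x (k + 1) = x k + s k := fun k => by rw [h.step k, hxs k]
  have hsk : ∀ k, x (k + 1) - x k = s k := fun k => by rw [hxs k]; simp
  simp only [← hxs] at hcurv hcurv' hdec
  have hBs : ∀ k, B k *ᵥ WithLp.ofLp (s k) = -(t k • WithLp.ofLp (gradient f (x k))) := by
    intro k
    rw [hst, searchDirection, smul_neg, WithLp.ofLp_neg, WithLp.ofLp_smul, Matrix.toLpLin_apply,
      mulVec_neg, mulVec_smul, mulVec_mulVec,
      mul_nonsing_inv _ ((isUnit_iff_isUnit_det _).1 (hB k).isUnit), one_mulVec]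
  have hnorm : ∀ k, ‖s k‖ ^ 2 ≤
      C₁ * ((Q⁻¹ *ᵥ WithLp.ofLp (s k)) ⬝ᵥ (Q⁻¹ *ᵥ WithLp.ofLp (s k))) := by
    intro k
    have := hQ1 (Q⁻¹ *ᵥ WithLp.ofLp (s k))
    rwa [hQQ, ← EuclideanSpace.norm_sq_eq_dotProduct] at this
  have hnorm' : ∀ k, (Q⁻¹ *ᵥ WithLp.ofLp (s k)) ⬝ᵥ (Q⁻¹ *ᵥ WithLp.ofLp (s k)) ≤
      C₂ * ‖s k‖ ^ 2 := by
    intro k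
    rw [EuclideanSpace.norm_sq_eq_dotProduct]
    exact hQ2 _
  have hsub : ∀ k, Qᵀ *ᵥ WithLp.ofLp (gradient f (x (k + 1)))
      - Qᵀ *ᵥ WithLp.ofLp (gradient f (x k)) =
      Qᵀ *ᵥ WithLp.ofLp (gradient f (x (k + 1)) - gradient f (x k)) := by
    intro k
    rw [WithLp.ofLp_sub, mulVec_sub]
  have hgs : ∀ k, (Qᵀ *ᵥ WithLp.ofLp (gradient f (x k))) ⬝ᵥ (Q⁻¹ *ᵥ WithLp.ofLp (s k)) =
      inner ℝ (gradient f (x k)) (s k) := by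
    intro k
    rw [hdot, EuclideanSpace.real_inner_eq_dotProduct]
  have hys : ∀ k, (Qᵀ *ᵥ WithLp.ofLp (gradient f (x (k + 1)))
      - Qᵀ *ᵥ WithLp.ofLp (gradient f (x k))) ⬝ᵥ (Q⁻¹ *ᵥ WithLp.ofLp (s k)) =
      inner ℝ (gradient f (x (k + 1)) - gradient f (x k)) (s k) := by
    intro k
    rw [hsub, hdot, EuclideanSpace.real_inner_eq_dotProduct]
  have hN : NormalizedBroyden (1 - φmax) (m / C₂) (K * C₁) (Real.sqrt (C₃ * C₁) * M)
      (C₄ / (2 * m)) φ (fun k => Qᵀ * B k * Q)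
      (fun k => Qᵀ *ᵥ WithLp.ofLp (gradient f (x k))) (fun k => Q⁻¹ *ᵥ WithLp.ofLp (s k)) t
      (fun k => f (x k) - f a) := by
    constructor
    · intro k
      exact ⟨(hφ k).1, by linarith [(hφ k).2]⟩
    · intro k
      exact (Matrix.IsUnit.posDef_star_left_conjugate_iff hQ).2 (hB k)
    · intro k
      rw [hsub, ← transpose_mul_broydenHessianUpdate_mul (hB k) _ hQ, hQQ, h.update k (hg k), hsk]
      rw [hQQ]
      exact dotProduct_mulVec_self_pos (hB k) (by simpa using hs k)
    · exact ht
    · intro k h0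
      have := hQQ (WithLp.ofLp (s k))
      rw [h0, mulVec_zero] at this
      exact hs k (by simpa using this.symm)
    · intro k
      rw [← mulVec_mulVec, ← mulVec_mulVec, hQQ, hBs, mulVec_neg, mulVec_smul]
    · intro k
      rw [hys, hgs]
      exact hcurv k
    · intro k
      rw [hys, hgs]
      exact hcurv' k
    · intro k
      rw [hys]
      have h1 := hsc.mul_sq_le_inner hf.contDiff (hx k) (hx (k + 1))
      rw [hsk] at h1
      refine le_trans ?_ h1
      rw [div_mul_eq_mul_div, div_le_iff₀ hC₂]
      have := mul_le_mul_of_nonneg_left (hnorm' k) hm.le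
      linarith
    · intro k
      rw [hgs]
      refine (hslope k).trans ?_
      rw [mul_assoc]
      exact mul_le_mul_of_nonneg_left (hnorm k) hK.le
    · intro k
      rw [hsub]
      have h1 := hMlip _ _ (hx k) (hx (k + 1))
      rw [hsk] at h1
      calc _ ≤ _ := hQ3 _
        _ = C₃ * ‖gradient f (x (k + 1)) - gradient f (x k)‖ ^ 2 := by
          rw [EuclideanSpace.norm_sq_eq_dotProduct]
        _ ≤ C₃ * (M * ‖s k‖) ^ 2 := by gcongr
        _ = C₃ * M ^ 2 * ‖s k‖ ^ 2 := by ring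
        _ ≤ C₃ * M ^ 2 * (C₁ * _) := mul_le_mul_of_nonneg_left (hnorm k) (by positivity)
        _ = _ := by rw [mul_pow, Real.sq_sqrt (by positivity)]; ring
    · intro k
      have : f a ≤ f (x k) := by
        rcases eq_or_ne (x k) a with h0 | h0
        · rw [h0]
        · exact (hmin _ h0).le
      simpa using this
    · intro k
      have h1 := hsc.sub_le_sq_norm_gradient hf.contDiff hm (hx k) ha
      refine h1.trans ?_
      rw [div_mul_eq_mul_div]
      gcongr
      have h2 := hQ4 (Qᵀ *ᵥ WithLp.ofLp (gradient f (x k)))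
      rwa [hQT, ← EuclideanSpace.norm_sq_eq_dotProduct] at h2
    · intro k
      rw [hgs]
      linarith [hdec k]
  have hε : 0 < 1 - φmax := by linarith
  have hF := hN.tendsto_zero hε (by positivity) (by positivity) (by positivity) (by positivity)
  have hxa : ∀ k, ‖x k - a‖ ≤ Real.sqrt (2 / m) * Real.sqrt (f (x k) - f a) := by
    intro k
    have h1 := hsc.add_inner_add_le hf.contDiff ha (hx k)
    rw [hga, inner_zero_left] at h1
    rw [← Real.sqrt_mul (by positivity)]
    refine Real.le_sqrt_of_sq_le ?_
    rw [div_mul_eq_mul_div, le_div_iff₀ hm]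
    linarith
  have hlim : Tendsto x atTop (𝓝 a) := by
    refine tendsto_iff_norm_sub_tendsto_zero.2 (squeeze_zero (fun k => norm_nonneg _) hxa ?_)
    have := ((Real.continuous_sqrt.tendsto 0).comp hF).const_mul (Real.sqrt (2 / m))
    simpa using this
  have hT := hN.tendsto_gradient_div_step hε (by positivity) (by positivity) (by positivity)
    (by positivity) (L := Real.sqrt (C₃ * C₁) * L * (2 * Real.sqrt (2 / m))) (by positivity) (by
      have hball : ∀ᶠ k in atTop, ‖x k - a‖ < r := by
        filter_upwards [hlim (Metric.ball_mem_nhds a hr)] with k hk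
        exact mem_ball_iff_norm.1 hk
      filter_upwards [hball, (tendsto_add_atTop_nat 1).eventually hball] with k hk hk1
      have h1 := hlin _ _ hk hk1
      rw [hsk] at h1
      have h2 : Qᵀ *ᵥ WithLp.ofLp (gradient f (x (k + 1))) - Qᵀ *ᵥ WithLp.ofLp (gradient f (x k))
          - Q⁻¹ *ᵥ WithLp.ofLp (s k) = Qᵀ *ᵥ WithLp.ofLp (gradient f (x (k + 1))
            - gradient f (x k) - fderiv ℝ (gradient f) a (s k)) := by
        have h3 : Q⁻¹ *ᵥ WithLp.ofLp (s k) = Qᵀ *ᵥ (G *ᵥ WithLp.ofLp (s k)) := by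
          have h4 : Qᵀ *ᵥ (G *ᵥ (Q *ᵥ (Q⁻¹ *ᵥ WithLp.ofLp (s k)))) =
              Q⁻¹ *ᵥ WithLp.ofLp (s k) := by
            rw [mulVec_mulVec, mulVec_mulVec, hQG, one_mulVec]
          rw [hQQ] at h4
          exact h4.symm
        rw [hsub, WithLp.ofLp_sub _ (gradient f (x (k + 1)) - gradient f (x k)), mulVec_sub, hGm,
          h3]
      have h5 : ‖x k - a‖ + ‖x (k + 1) - a‖ ≤
          2 * Real.sqrt (2 / m) * Real.sqrt (f (x k) - f a) := by
        have h6 : Real.sqrt (f (x (k + 1)) - f a) ≤ Real.sqrt (f (x k) - f a) := by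
          apply Real.sqrt_le_sqrt
          have := hN.decrease k
          have := hN.slope_pos (by positivity) k
          simp only at *
          linarith
        have h7 := mul_le_mul_of_nonneg_left h6 (Real.sqrt_nonneg (2 / m))
        linarith [hxa k, hxa (k + 1)]
      rw [h2]
      calc _ ≤ _ := hQ3 _
        _ = C₃ * ‖gradient f (x (k + 1)) - gradient f (x k)
            - fderiv ℝ (gradient f) a (s k)‖ ^ 2 := by
          rw [EuclideanSpace.norm_sq_eq_dotProduct]
        _ ≤ C₃ * (L * (2 * Real.sqrt (2 / m) * Real.sqrt (f (x k) - f a)) * ‖s k‖) ^ 2 := by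
          have := h1.trans (mul_le_mul_of_nonneg_right (mul_le_mul_of_nonneg_left h5 hL)
            (norm_nonneg (s k)))
          gcongr
        _ = C₃ * (L * (2 * Real.sqrt (2 / m) * Real.sqrt (f (x k) - f a))) ^ 2 * ‖s k‖ ^ 2 := by
          ring
        _ ≤ C₃ * (L * (2 * Real.sqrt (2 / m) * Real.sqrt (f (x k) - f a))) ^ 2 * (C₁ * _) :=
          mul_le_mul_of_nonneg_left (hnorm k) (by positivity)
        _ = _ := by
          rw [mul_assoc (Real.sqrt (C₃ * C₁)), mul_assoc (Real.sqrt (C₃ * C₁)),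
            mul_pow (Real.sqrt (C₃ * C₁)), Real.sq_sqrt (by positivity)]
          ring)
  refine convergesQSuperlinearly_of_gradient_isLittleO (g := fun k => gradient f (x k)) hm hlim
    (fun k => ?_) (IsLittleO.of_bound fun c hc => ?_)
  · have := hsc.mul_norm_le hf.contDiff ha (hx k)
    rwa [hga, sub_zero] at this
  · filter_upwards [hT.eventually_le_const (show 0 < c ^ 2 / (C₄ * C₂) by positivity)] with k hk
    have hsp := dotProduct_self_pos (hN.s_ne k)
    rw [div_le_iff₀ hsp] at hk
    rw [hsk]
    refine abs_le_of_sq_le_sq' ?_ (by positivity) |>.2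
    have h2 := hQ4 (Qᵀ *ᵥ WithLp.ofLp (gradient f (x (k + 1))))
    rw [hQT, ← EuclideanSpace.norm_sq_eq_dotProduct] at h2
    calc _ ≤ _ := h2
      _ ≤ C₄ * (c ^ 2 / (C₄ * C₂) * _) := mul_le_mul_of_nonneg_left hk hC₄.le
      _ ≤ C₄ * (c ^ 2 / (C₄ * C₂) * (C₂ * ‖s k‖ ^ 2)) := by
        gcongr
        exact hnorm' k
      _ = _ := by field_simp

lemma IsAdaptiveBroyden.convergesQSuperlinearly (hf : StandardSelfConcordant f) (hm : 0 < m)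
    (hsc : StrongConvexOn {z | f z ≤ f x₀} m f) (ha : f a ≤ f x₀) (hga : gradient f a = 0)
    (hmin : ∀ z, z ≠ a → f a < f z) {φ : ℕ → ℝ} {φmax : ℝ} (hφmax : φmax < 1)
    (hφ : ∀ k, 0 ≤ φ k ∧ φ k ≤ φmax)
    {x : ℕ → EuclideanSpace ℝ (Fin n)} {B : ℕ → Matrix (Fin n) (Fin n) ℝ}
    (h : IsAdaptiveBroyden f φ x₀ x B) : ConvergesQSuperlinearly x a := by
  by_cases hg : ∀ k, gradient f (x k) ≠ 0
  · exact h.convergesQSuperlinearly_of_ne hf hm hsc ha hga hmin hφmax hφ hg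
  push Not at hg
  obtain ⟨N, hN⟩ := hg
  have hxN : x N = a := by
    by_contra hne
    have := (strongConvexOn_zero.2 hf.convex).add_inner_add_le hf.contDiff (Set.mem_univ (x N))
      (Set.mem_univ a)
    rw [hN, inner_zero_left] at this
    linarith [hmin _ hne]
  refine convergesQSuperlinearly_of_eventually_eq (N := N) fun k hk => ?_
  induction k, hk using Nat.le_induction with
  | base => exact hxN
  | succ k _ ih => rw [h.step k, adaptiveStep_eq_self (by rw [ih, hga]), ih]

/-- Adaptive BFGS is the Broyden method with parameter `0`, applied to the inverse matrices. -/
lemma IsAdaptiveBFGS.isAdaptiveBroyden (hf : StandardSelfConcordant f) (hm : 0 < m)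
    (hsc : StrongConvexOn {z | f z ≤ f x₀} m f)
    {x : ℕ → EuclideanSpace ℝ (Fin n)} {H : ℕ → Matrix (Fin n) (Fin n) ℝ}
    (h : IsAdaptiveBFGS f x₀ x H) :
    IsAdaptiveBroyden f (fun _ => 0) x₀ x (fun k => (H k)⁻¹) := by
  -- A vanishing gradient stays zero, so nothing is known of `H k` once a gradient has vanished.
  have hinv : ∀ k, gradient f (x k) ≠ 0 → f (x k) ≤ f x₀ ∧ (H k).PosDef := by
    intro k
    induction k with
    | zero => exact fun _ => ⟨by rw [h.start], h.posDef⟩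
    | succ k ih =>
      intro hg'
      have hg : gradient f (x k) ≠ 0 := fun h0 => by
        rw [h.step k, adaptiveStep_eq_self h0] at hg'
        exact hg' h0
      obtain ⟨hx, hH⟩ := ih hg
      obtain ⟨h1, h2, h3⟩ := adaptiveStep_mem_levelSet hf hm hsc hH hx hg (h.step k)
      refine ⟨h1, ?_⟩
      have h4 := dotProduct_mulVec_self_pos hH.inv h2
      rw [h.update k hg, ← posDef_inv_iff, inv_bfgsUpdate hH h4 h3]
      exact posDef_bfgsHessianUpdate hH.inv h4 h3
  refine ⟨h.start, h.posDef.inv, fun k => ?_, fun k hg => ?_⟩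
  · by_cases hg : gradient f (x k) = 0
    · rw [h.step k, adaptiveStep_eq_self hg, adaptiveStep_eq_self hg]
    · rw [nonsing_inv_nonsing_inv _ ((isUnit_iff_isUnit_det _).1 (hinv k hg).2.isUnit)]
      exact h.step k
  · obtain ⟨hx, hH⟩ := hinv k hg
    obtain ⟨-, h2, h3⟩ := adaptiveStep_mem_levelSet hf hm hsc hH hx hg (h.step k)
    rw [h.update k hg, inv_bfgsUpdate hH (dotProduct_mulVec_self_pos hH.inv h2) h3,
      broydenHessianUpdate, sub_zero, one_smul, zero_smul, add_zero]

end Convergence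

end

theorem mainTheorem1 (n : ℕ) (f : EuclideanSpace ℝ (Fin n) → ℝ) (hf : StandardSelfConcordant f)
    (x₀ : EuclideanSpace ℝ (Fin n)) (m : ℝ) (hm : 0 < m)
    (hsc : StrongConvexOn {z | f z ≤ f x₀} m f) :
    ∃ a : EuclideanSpace ℝ (Fin n),
      (∀ z, z ≠ a → f a < f z) ∧
      (∀ (x : ℕ → EuclideanSpace ℝ (Fin n)) (H : ℕ → Matrix (Fin n) (Fin n) ℝ),
        IsAdaptiveBFGS f x₀ x H → ConvergesQSuperlinearly x a) ∧
      (∀ (φ : ℕ → ℝ) (φmax : ℝ), φmax < 1 → (∀ k, 0 ≤ φ k ∧ φ k ≤ φmax) →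
        ∀ (x : ℕ → EuclideanSpace ℝ (Fin n)) (B : ℕ → Matrix (Fin n) (Fin n) ℝ),
          IsAdaptiveBroyden f φ x₀ x B → ConvergesQSuperlinearly x a) := by
  obtain ⟨a, ha, hga, hmin⟩ := exists_minimizer hf.contDiff hm hsc
  refine ⟨a, hmin, fun x H h => ?_, fun φ φmax hφmax hφ x B h => ?_⟩
  · exact (h.isAdaptiveBroyden hf hm hsc).convergesQSuperlinearly hf hm hsc ha hga hmin
      zero_lt_one (fun _ => ⟨le_rfl, le_rfl⟩)
  · exact h.convergesQSuperlinearly hf hm hsc ha hga hmin hφmax hφ
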